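/- Let $d_0,d_1\ge 4$ and let $T$ be the $(d_0,d_1)$-semiregular tree, with canonical bipartition $V(T)=V_0(T)\sqcup V_1(T)$, where each vertex of type $t\in\{0,1\}$ (i.e. in $V_t(T)$) has exactly $d_t$ neighbours. Let $\mathrm{Aut}(T)^+$ be the group of type-preserving automorphisms of $T$; $\mathrm{Aut}(T)$ carries the topology of pointwise convergence on $V(T)$, and $\partial T$ is the set of ends of $T$. For $v\in V(T)$ and $r\in\mathbb N$, let $S(v,r)$ be the set of vertices at distance $r$ from $v$, and for $Y\subset\mathbb N$ let $S_Y(v)=\bigcup_{r\in Y}S(v,r)$. Let $i$ be a legal coloring of $T$, i.e. a map on $V(T)$ such that, for each $t\in\{0,1\}$ and each $v\in V_t(T)$, the restriction of $i$ to $S(v,1)$ is a bijection onto $\{1,\dots,d_t\}$. For $g\in\mathrm{Aut}(T)$ and $v\in V(T)$, let $\sigma_{(i)}(g,v)=i|_{S(g(v),1)}\circ g\circ i|_{S(v,1)}^{-1}$, a permutation of $\{1,\dots,d_t\}$ if $v\in V_t(T)$. For finite, possibly empty, subsets $Y_0,Y_1$ of $\mathbb N$, let $G^+_{(i)}(Y_0,Y_1)$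 be the group of all $g\in\mathrm{Aut}(T)^+$ such that for each $t\in\{0,1\}$ $$\prod_{w\in S_{Y_t}(v)}\mathrm{sgn}(\sigma_{(i)}(g,w))=1\quad\text{for every vertex } v \text{ of type } (t+\max Y_t)\bmod 2,$$ where $\max\varnothing=0$. Then: (i) $G^+_{(i)}(Y_0,Y_1)$ is a closed subgroup of $\mathrm{Aut}(T)$, contained in $\mathrm{Aut}(T)^+$, and acts $2$-transitively on $\partial T$. (ii) $G^+_{(i)}(Y_0,Y_1)$ is simple as an abstract group. (iii) $N_{\mathrm{Aut}(T)^+}(G^+_{(i)}(Y_0,Y_1))/G^+_{(i)}(Y_0,Y_1)\cong (C_2)^k$ with $k=|\{t\in\{0,1\}: Y_t\ne\varnothing\}|$, where $C_2$ is the cyclic group of order $2$. If $d_0=d_1$ and $Y_0=Y_1=:Y\ne\varnothing$, then $N_{\mathrm{Aut}(T)}(G^+_{(i)}(Y,Y))/G^+_{(i)}(Y,Y)\cong D_8$, the dihedral group of order $8$. -/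

import Mathlib

/-! # Semiregular trees, their ends, their automorphism groups, and legal colorings -/

namespace SemiTree

variable {V : Type*}

/-- `T` is the `(d 0, d 1)`-semiregular tree, and `type : V → Fin 2` is its bipartition:
`T` is a tree, adjacent vertices have different types, and each vertex of type `t` has exactly
`d t` neighbours. (Only positive `d t` are of interest, so that neighbourhoods are finite.) -/
structure IsSemiregularTree (T : SimpleGraph V) (d : Fin 2 → ℕ) (type : V → Fin 2) : Prop where
  isTree : T.IsTree
  type_ne : ∀ ⦃v w : V⦄, T.Adj v w → type v ≠ type w
  ncard_neighborSet : ∀ v : V, (T.neighborSet v).ncard = d (type v)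

/-- A legal coloring: for every vertex `v` of type `t`, the map `i` restricts to a bijection from
the sphere `S(v,1)` of neighbours of `v` onto `{1, …, d t}`. (As each vertex of type `t` is a
neighbour of one of type `1 - t`, it has its color in `{1, …, d (1 - t)}`.) -/
def IsLegalColoring (T : SimpleGraph V) (d : Fin 2 → ℕ) (type : V → Fin 2) (i : V → ℕ) : Prop :=
  ∀ v : V, Set.BijOn i (T.neighborSet v) (Set.Icc 1 (d (type v)))

/-! ## The topology of `Aut(T)` -/

/-- The topology of pointwise convergence on `Aut(T)` (the vertex set being discrete). -/
instance autTopology (T : SimpleGraph V) : TopologicalSpace (T ≃g T) :=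
  TopologicalSpace.induced (fun (g : T ≃g T) (v : V) => g v)
    (@Pi.topologicalSpace V (fun _ => V) (fun _ => ⊥))

/-! ## Ends -/

/-- Rays: one-sided infinite paths without repeated vertices. -/
def Ray (T : SimpleGraph V) : Type _ :=
  {r : ℕ → V // (∀ n, T.Adj (r n) (r (n + 1))) ∧ Function.Injective r}

/-- Two rays of a tree are equivalent if they coincide from some point on, up to a shift. -/
instance raySetoid (T : SimpleGraph V) : Setoid (Ray T) where
  r r s := ∃ m n : ℕ, ∀ k : ℕ, r.1 (m + k) = s.1 (n + k)
  iseqv :=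
    { refl := fun _ => ⟨0, 0, fun _ => rfl⟩
      symm := fun ⟨m, n, h⟩ => ⟨n, m, fun k => (h k).symm⟩
      trans := fun {a b c} ⟨m, n, h⟩ ⟨m', n', h'⟩ => ⟨m + m', n' + n, fun k => by
        have h1 := h (m' + k)
        have h2 := h' (n + k)
        rw [show m + m' + k = m + (m' + k) by omega, h1,
          show n + (m' + k) = m' + (n + k) by omega, h2, Nat.add_assoc]⟩ }

/-- The set `∂T` of ends of a tree. -/
def Ends (T : SimpleGraph V) : Type _ := Quotient (raySetoid T)

/-- The image of a ray under an automorphism. -/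
def Ray.map {T : SimpleGraph V} (g : T ≃g T) (r : Ray T) : Ray T :=
  ⟨fun n => g (r.1 n), fun n => g.map_adj_iff.2 (r.2.1 n), g.injective.comp r.2.2⟩

/-- The action of `Aut(T)` on `∂T`. -/
instance endsAction (T : SimpleGraph V) : MulAction (T ≃g T) (Ends T) where
  smul g := Quotient.map (Ray.map g) (fun _ _ ⟨m, n, h⟩ => ⟨m, n, fun k => congrArg g (h k)⟩)
  one_smul e := by
    induction e using Quotient.inductionOn
    rfl
  mul_smul g h e := by
    induction e using Quotient.inductionOn
    rfl

/-! ## Type-preserving automorphisms -/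

/-- The group `Aut(T)⁺` of all automorphisms of `T` that preserve the types of the vertices. -/
def autPlus (T : SimpleGraph V) (type : V → Fin 2) : Subgroup (T ≃g T) where
  carrier := {g | ∀ v, type (g v) = type v}
  one_mem' := fun _ => rfl
  mul_mem' := fun {g h} hg hh v => (hg (h v)).trans (hh v)
  inv_mem' := fun {g} hg v => by
    have := hg (g⁻¹ v)
    rwa [RelIso.apply_inv_self, eq_comm] at this

/-! ## Local actions -/

variable {T : SimpleGraph V} {d : Fin 2 → ℕ} {type : V → Fin 2} {i : V → ℕ}

/-- The bijection `S(v,1) → S(g(v),1)` induced by an automorphism `g`. -/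
def neighborEquiv (g : T ≃g T) (v : V) : T.neighborSet v ≃ T.neighborSet (g v) :=
  g.toEquiv.subtypeEquiv (fun _ => g.map_adj_iff.symm)

/-- An automorphism preserves the number of neighbours, hence the set of colors. -/
theorem IsLegalColoring.bijOn_apply (hi : IsLegalColoring T d type i) (g : T ≃g T) (v : V) :
    Set.BijOn i (T.neighborSet (g v)) (Set.Icc 1 (d (type v))) := by
  have e := ((Set.BijOn.equiv i (hi v)).symm.trans (neighborEquiv g v)).trans (Set.BijOn.equiv i (hi (g v)))
  have h := Fintype.card_congr e
  simp only [Fintype.card_ofFinset, Nat.card_Icc, Nat.add_sub_cancel] at h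
  rw [h]
  exact hi (g v)

/-- The local action `σ(g,v) = i|_{S(g(v),1)} ∘ g ∘ i|_{S(v,1)}⁻¹`, a permutation of
`{1, …, d t}` for `v` of type `t`. -/
noncomputable def localAction (hi : IsLegalColoring T d type i) (g : T ≃g T) (v : V) :
    Equiv.Perm (Set.Icc 1 (d (type v))) :=
  ((Set.BijOn.equiv i (hi v)).symm.trans (neighborEquiv g v)).trans (Set.BijOn.equiv i (hi.bijOn_apply g v))

/-- The signature of the local action at a vertex. -/
noncomputable def sgn (hi : IsLegalColoring T d type i) (g : T ≃g T) (v : V) : ℤˣ :=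
  Equiv.Perm.sign (localAction hi g v)

/-- `S_Y(v)`: the set of vertices whose distance from `v` lies in `Y`. -/
def spheres (T : SimpleGraph V) (Y : Finset ℕ) (v : V) : Set V := {w | T.dist v w ∈ Y}

/-- The product of the signatures of the local actions of `g` at the vertices of `S_Y(v)`
(a finite set in a semiregular tree, see `spheres_finite`). -/
noncomputable def sgnProd (hi : IsLegalColoring T d type i) (g : T ≃g T) (Y : Finset ℕ) (v : V) :
    ℤˣ :=
  ∏ᶠ w ∈ spheres T Y v, sgn hi g w

/-! ### Facts needed to see that the groups below are groups -/

theorem spheres_finite (hT : IsSemiregularTree T d type) (hi : IsLegalColoring T d type i)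
    (Y : Finset ℕ) (v : V) : (spheres T Y v).Finite := by
  have hN : ∀ w, (T.neighborSet w).Finite := fun w => (hi w).finite_iff_finite.2 (Set.finite_Icc _ _)
  have hS : ∀ n, {w | T.dist v w = n}.Finite := by
    intro n
    induction n with
    | zero =>
      refine (Set.finite_singleton v).subset fun w hw => ?_
      exact ((hT.isTree.connected.dist_eq_zero_iff).1 hw).symm
    | succ n ih =>
      refine (ih.biUnion fun u _ => hN u).subset fun w hw => ?_
      obtain ⟨p, hp⟩ := hT.isTree.connected.exists_walk_length_eq_dist w v
      rw [SimpleGraph.dist_comm, show T.dist v w = n + 1 from hw] at hp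
      cases p with
      | nil => simp at hp
      | @cons _ u _ h q =>
        simp only [SimpleGraph.Walk.length_cons, Nat.add_right_cancel_iff] at hp
        refine Set.mem_biUnion (x := u) ?_ h.symm
        have h1 : T.dist u v ≤ n := hp ▸ SimpleGraph.dist_le q
        have h2 : T.dist v w ≤ T.dist v u + T.dist u w := hT.isTree.connected.dist_triangle
        have h3 : T.dist u w = 1 := SimpleGraph.dist_eq_one_iff_adj.2 h.symm
        have h4 : T.dist v w = n + 1 := hw
        rw [SimpleGraph.dist_comm] at h1
        show T.dist v u = n
        omega
  refine (Y.finite_toSet.biUnion fun n _ => hS n).subset fun w hw => ?_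
  exact Set.mem_biUnion (x := T.dist v w) hw rfl

theorem dist_apply (hT : IsSemiregularTree T d type) (g : T ≃g T) (v w : V) :
    T.dist (g v) (g w) = T.dist v w := by
  have key : ∀ (g : T ≃g T) (v w : V), T.dist (g v) (g w) ≤ T.dist v w := by
    intro g v w
    obtain ⟨p, hp⟩ := hT.isTree.connected.exists_walk_length_eq_dist v w
    rw [← hp, ← SimpleGraph.Walk.length_map g.toHom p]
    exact SimpleGraph.dist_le _
  refine le_antisymm (key g v w) ?_
  have := key g⁻¹ (g v) (g w)
  rwa [RelIso.inv_apply_self, RelIso.inv_apply_self] at this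

theorem sgn_one (hi : IsLegalColoring T d type i) (v : V) : sgn hi 1 v = 1 := by
  have : localAction hi 1 v = 1 := by
    ext x
    exact congrArg Subtype.val ((Set.BijOn.equiv i (hi v)).apply_symm_apply x)
  rw [sgn, this, map_one]

theorem sgn_mul (hi : IsLegalColoring T d type i) (g h : T ≃g T) (v : V) :
    sgn hi (g * h) v = sgn hi g (h v) * sgn hi h v := by
  have hc : Set.Icc 1 (d (type v)) = Set.Icc 1 (d (type (h v))) := by
    rw [← (hi.bijOn_apply h v).image_eq, (hi (h v)).image_eq]
  have : localAction hi (g * h) v =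
      ((Equiv.setCongr hc).trans ((localAction hi g (h v)).trans (Equiv.setCongr hc.symm))) *
        localAction hi h v := by
    ext x
    obtain ⟨u, rfl⟩ := (Set.BijOn.equiv i (hi v)).surjective x
    have hu : (Equiv.setCongr hc) ((Set.BijOn.equiv i (hi.bijOn_apply h v)) (neighborEquiv h v u)) =
        (Set.BijOn.equiv i (hi (h v))) (neighborEquiv h v u) := by
      apply Subtype.ext
      rfl
    simp only [localAction, Equiv.Perm.mul_apply, Equiv.trans_apply, Equiv.symm_apply_apply, hu]
    rfl
  rw [sgn, this, Equiv.Perm.sign_mul]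
  congr 1
  exact Equiv.Perm.sign_symm_trans_trans (localAction hi g (h v)) (Equiv.setCongr hc.symm)

theorem sgnProd_one (hi : IsLegalColoring T d type i) (Y : Finset ℕ) (v : V) :
    sgnProd hi 1 Y v = 1 := by
  simp [sgnProd, sgn_one]

theorem sgnProd_mul (hT : IsSemiregularTree T d type) (hi : IsLegalColoring T d type i)
    (g h : T ≃g T) (Y : Finset ℕ) (v : V) :
    sgnProd hi (g * h) Y v = sgnProd hi g Y (h v) * sgnProd hi h Y v := by
  have hb : Set.BijOn h (spheres T Y v) (spheres T Y (h v)) := by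
    refine ⟨fun w hw => ?_, h.injective.injOn, fun w hw => ⟨h⁻¹ w, ?_, h.apply_symm_apply w⟩⟩
    · show T.dist (h v) (h w) ∈ Y
      rw [dist_apply hT]
      exact hw
    · show T.dist v (h⁻¹ w) ∈ Y
      rw [← dist_apply hT h, RelIso.apply_inv_self]
      exact hw
  simp only [sgnProd, sgn_mul]
  rw [finprod_mem_mul_distrib (spheres_finite hT hi Y v)]
  congr 1
  exact finprod_mem_eq_of_bijOn h hb fun _ _ => rfl

/-! ## The groups `G⁺(Y₀, Y₁)` -/

/-- The group `G⁺(Y 0, Y 1)` of all `g ∈ Aut(T)⁺` such that, for each `t ∈ {0, 1}` and each vertex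
`v` of type `(t + max (Y t)) mod 2`, the product over `w ∈ S_{Y t}(v)` of the signatures of the
local actions `σ(g,w)` is `1`; here `max ∅ = 0`. -/
noncomputable def GPlus (hT : IsSemiregularTree T d type) (hi : IsLegalColoring T d type i)
    (Y : Fin 2 → Finset ℕ) : Subgroup (T ≃g T) where
  carrier := {g | g ∈ autPlus T type ∧
    ∀ t : Fin 2, ∀ v : V, (type v : ℕ) = ((t : ℕ) + (Y t).sup id) % 2 → sgnProd hi g (Y t) v = 1}
  one_mem' := ⟨one_mem _, fun t v _ => sgnProd_one hi (Y t) v⟩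
  mul_mem' := fun {g h} hg hh => ⟨mul_mem hg.1 hh.1, fun t v hv => by
    rw [sgnProd_mul hT, hh.2 t v hv, hg.2 t (h v) (by rw [hh.1 v]; exact hv), one_mul]⟩
  inv_mem' := fun {g} hg => ⟨inv_mem hg.1, fun t v hv => by
    have h1 := sgnProd_mul hT hi g g⁻¹ (Y t) v
    rw [mul_inv_cancel, sgnProd_one, hg.2 t (g⁻¹ v) (by rw [inv_mem hg.1 v]; exact hv),
      one_mul] at h1
    exact h1.symm⟩

/-- The quotient `N_G(H) / H` of the normalizer of `H` in `G` by `H`. -/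
abbrev NormalizerQuotient {G : Type*} [Group G] (H : Subgroup G) : Type _ :=
  Subgroup.normalizer (H : Set G) ⧸ H.subgroupOf (Subgroup.normalizer (H : Set G))

end SemiTree

/-! Everything rests on building automorphisms with prescribed signatures. A type-preserving map
given on a subtree extends outwards vertex by vertex, and as all degrees are at least 4, the
signature at a vertex is free as long as at most two images of its neighbours are already prescribed
(`exists_aut_extending`). Seen from a root, the conditions defining `GPlus` form a triangular system
of sign equations, in which an outermost vertex of each sphere serves as pivot
(`exists_signs_spheres`). So they can be solved, with any right-hand sides, around suitable given
values.

The group is closed because each condition involves finitely many vertices. It is 2-transitive on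
ends because lines with base points of the same type are conjugate by an element with all signatures
1 (`exists_aut_line`).

For simplicity, a nontrivial normal subgroup `N` contains some `m` shifting a half-tree into itself
(`exists_shift`). An element supported on a half-tree with disjoint translates under the powers of
`m` is a commutator of `m` with an infinite product (`mem_of_supported`). Hence `N` contains every
element that splits along an edge into two elements of the group, then every element with all
signatures 1 (`mem_of_even`) and every element fixing a large ball (`mem_of_fix_ball`). In
`GPlus_le_of_normal` an arbitrary element is factored into such ones.

For the normalizer, `sgnProd` is a cocycle and `GPlus` is transitive on each type, so the products
of a normalizing element are constant on the vertices of each condition. These constants are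
arbitrary and are the coordinates on the quotient; together with the exchange of types they form the
wreath product of two groups of order 2, which is dihedral of order 8. -/

namespace SemiTree

open Set

/-! ### Distances, geodesics and half-trees in a tree. -/

section TreeGeometry

variable {V : Type*} {T : SimpleGraph V}

theorem dist_adj (hT : T.IsTree) (p : V) {u w : V} (h : T.Adj u w) :
    T.dist p w = T.dist p u + 1 ∨ T.dist p u = T.dist p w + 1 :=
  (hT.dist_eq_dist_add_one_of_adj p h).symm

theorem dist_symm (T : SimpleGraph V) (u v : V) : T.dist u v = T.dist v u :=
  SimpleGraph.dist_comm

theorem dist_tri (hT : T.IsTree) (u v w : V) : T.dist u w ≤ T.dist u v + T.dist v w :=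
  hT.connected.dist_triangle

theorem eq_of_dist_zero (hT : T.IsTree) {u v : V} (h : T.dist u v = 0) : u = v :=
  hT.connected.dist_eq_zero_iff.1 h

/-- Geodesics exist: there is a neighbour of `w` one step closer to `p`. -/
theorem exists_closer (hT : T.IsTree) {p w : V} (h : T.dist p w ≠ 0) :
    ∃ u, T.Adj u w ∧ T.dist p w = T.dist p u + 1 := by
  obtain ⟨q, hq⟩ := hT.connected.exists_walk_length_eq_dist w p
  rw [T.dist_comm] at hq
  cases q with
  | nil => simp at h
  | @cons _ u _ hwu q =>
    refine ⟨u, hwu.symm, ?_⟩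
    have h1 := T.dist_le q
    rw [SimpleGraph.Walk.length_cons] at hq
    rw [T.dist_comm] at h1
    rcases dist_adj hT p hwu with h2 | h2 <;> omega

/-- In a tree, the neighbour of `w` closer to `p` is unique. -/
theorem closer_unique (hT : T.IsTree) {p u v w : V} (hu : T.Adj u w) (hv : T.Adj v w)
    (hdu : T.dist p w = T.dist p u + 1) (hdv : T.dist p w = T.dist p v + 1) : u = v := by
  have key : ∀ x, T.Adj x w → T.dist p w = T.dist p x + 1 →
      ∃ q : T.Walk w p, q.IsPath ∧ q.snd = x := by
    intro x hx hd
    obtain ⟨q, hq⟩ := hT.connected.exists_walk_length_eq_dist x p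
    refine ⟨SimpleGraph.Walk.cons hx.symm q, ?_, by simp⟩
    apply SimpleGraph.Walk.isPath_of_length_eq_dist
    rw [SimpleGraph.Walk.length_cons, hq, dist_symm T x p, dist_symm T w p, hd]
  obtain ⟨q, hq, rfl⟩ := key u hu hdu
  obtain ⟨q', hq', rfl⟩ := key v hv hdv
  rw [(hT.existsUnique_path w p).unique hq hq']

/-- At most one neighbour of `w` is closer to `p`, so a path that has moved away from `p` keeps
doing so until it backtracks. -/
theorem dist_of_ne_closer (hT : T.IsTree) {p u v w : V} (hu : T.Adj u w) (hv : T.Adj w v)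
    (hdu : T.dist p w = T.dist p u + 1) (hne : u ≠ v) : T.dist p v = T.dist p w + 1 := by
  rcases dist_adj hT p hv with h | h
  · exact h
  · exact absurd (closer_unique hT hu hv.symm hdu h) hne

theorem dist_eq_one {u v : V} (h : T.Adj u v) : T.dist u v = 1 :=
  SimpleGraph.dist_eq_one_iff_adj.2 h

/-- Non-backtracking paths. -/
def NonBacktracking (T : SimpleGraph V) (c : ℕ → V) : Prop :=
  (∀ n, T.Adj (c n) (c (n + 1))) ∧ ∀ n, c n ≠ c (n + 2)

theorem NonBacktracking.shift {c : ℕ → V} (h : NonBacktracking T c) (m : ℕ) :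
    NonBacktracking T (fun n => c (m + n)) :=
  ⟨fun n => h.1 (m + n), fun n => h.2 (m + n)⟩

theorem NonBacktracking.dist_zero (hT : T.IsTree) {c : ℕ → V} (h : NonBacktracking T c) (n : ℕ) :
    T.dist (c 0) (c n) = n := by
  suffices T.dist (c 0) (c n) = n ∧ T.dist (c 0) (c (n + 1)) = n + 1 from this.1
  induction n with
  | zero => exact ⟨by simp, dist_eq_one (h.1 0)⟩
  | succ n ih =>
    refine ⟨ih.2, ?_⟩
    have h1 := dist_of_ne_closer hT (p := c 0) (h.1 n) (h.1 (n + 1)) (by omega) (h.2 n)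
    rw [show n + 1 + 1 = n + 2 from rfl] at *
    omega

theorem NonBacktracking.dist (hT : T.IsTree) {c : ℕ → V} (h : NonBacktracking T c) (m n : ℕ) :
    T.dist (c m) (c (m + n)) = n := (h.shift m).dist_zero hT n

theorem NonBacktracking.injective (hT : T.IsTree) {c : ℕ → V} (h : NonBacktracking T c) :
    Function.Injective c := by
  have key : ∀ m n, m ≤ n → c m = c n → m = n := by
    intro m n hmn he
    have := h.dist hT m (n - m)
    rw [show m + (n - m) = n by omega, he, T.dist_self] at this
    omega
  intro m n he
  rcases le_total m n with hmn | hmn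
  · exact key m n hmn he
  · exact (key n m hmn he.symm).symm

/-- Bi-infinite geodesic lines. -/
def IsLine (T : SimpleGraph V) (l : ℤ → V) : Prop :=
  (∀ n, T.Adj (l n) (l (n + 1))) ∧ ∀ n, l n ≠ l (n + 2)

theorem IsLine.ray {l : ℤ → V} (h : IsLine T l) (m : ℤ) :
    NonBacktracking T (fun n => l (m + n)) :=
  ⟨fun n => by have := h.1 (m + n); rwa [add_assoc] at this, fun n => by
    have := h.2 (m + n); rwa [add_assoc] at this⟩

theorem IsLine.dist (hT : T.IsTree) {l : ℤ → V} (h : IsLine T l) (m n : ℤ) :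
    T.dist (l m) (l n) = (n - m).natAbs := by
  have key : ∀ (m : ℤ) (k : ℕ), T.dist (l m) (l (m + k)) = k := by
    intro m k
    have := (h.ray m).dist_zero hT k
    simpa using this
  rcases le_total m n with hmn | hmn
  · have := key m (n - m).natAbs
    rwa [show m + ((n - m).natAbs : ℤ) = n by omega] at this
  · have := key n (n - m).natAbs
    rw [show n + ((n - m).natAbs : ℤ) = m by omega] at this
    rwa [T.dist_comm]

theorem IsLine.injective (hT : T.IsTree) {l : ℤ → V} (h : IsLine T l) : Function.Injective l := by
  intro m n he
  have := h.dist hT m n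
  rw [he, T.dist_self] at this
  omega

theorem exists_line_of_rays {r s : ℕ → V} (hr : NonBacktracking T r)
    (hs : NonBacktracking T s) (h0 : r 0 = s 0) (h1 : r 1 ≠ s 1) :
    ∃ l : ℤ → V, IsLine T l ∧ (∀ n : ℕ, l n = r n) ∧ ∀ n : ℕ, l (-n) = s n := by
  let l : ℤ → V := fun n => if 0 ≤ n then r n.toNat else s (-n).toNat
  have hl1 : ∀ n : ℕ, l n = r n := fun n => by simp [l]
  have hl2 : ∀ n : ℕ, l (-n) = s n := by
    intro n
    rcases Nat.eq_zero_or_pos n with rfl | hn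
    · simpa [l] using h0
    · simp only [l]
      rw [if_neg (by omega)]
      simp
  refine ⟨l, ⟨fun n => ?_, fun n => ?_⟩, hl1, hl2⟩
  · rcases le_or_gt 0 n with hn | hn
    · lift n to ℕ using hn
      rw [show (n : ℤ) + 1 = ((n + 1 : ℕ) : ℤ) by push_cast; rfl, hl1, hl1]
      exact hr.1 n
    · obtain ⟨k, rfl⟩ : ∃ k : ℕ, n = -((k + 1 : ℕ) : ℤ) := ⟨(-n - 1).toNat, by omega⟩
      rw [show -((k + 1 : ℕ) : ℤ) + 1 = -(k : ℤ) by push_cast; ring, hl2, hl2]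
      exact (hs.1 k).symm
  · rcases le_or_gt 0 n with hn | hn
    · lift n to ℕ using hn
      rw [show (n : ℤ) + 2 = ((n + 2 : ℕ) : ℤ) by push_cast; rfl, hl1, hl1]
      exact hr.2 n
    · rcases eq_or_ne n (-1) with rfl | hn'
      · rw [show (-1 : ℤ) = -((1 : ℕ) : ℤ) by rfl, hl2,
          show -((1 : ℕ) : ℤ) + 2 = ((1 : ℕ) : ℤ) by rfl, hl1]
        exact h1.symm
      · obtain ⟨k, rfl⟩ : ∃ k : ℕ, n = -((k + 2 : ℕ) : ℤ) := ⟨(-n - 2).toNat, by omega⟩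
        rw [show -((k + 2 : ℕ) : ℤ) + 2 = -(k : ℤ) by push_cast; ring, hl2, hl2]
        exact (hs.2 k).symm

/-- The distance between points on different sides of the edge `r s`. -/
theorem dist_across (hT : T.IsTree) {r s v w : V} (h : T.Adj r s)
    (hw : T.dist w s < T.dist w r) (hv : T.dist v r < T.dist v s) :
    T.dist w v = T.dist w s + 1 + T.dist r v := by
  have hws : T.dist w r = T.dist w s + 1 := by
    rcases dist_adj hT w h with h1 | h1 <;> omega
  suffices ∀ k v, T.dist r v = k → T.dist v r < T.dist v s → T.dist w v = T.dist w s + 1 + k from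
    this _ v rfl hv
  clear hv v
  intro k
  induction k using Nat.strong_induction_on with
  | _ k ih =>
    intro v hk hv
    rcases k with _ | k
    · obtain rfl := eq_of_dist_zero hT hk
      exact hws
    obtain ⟨u, huv, hu⟩ := exists_closer hT (p := r) (w := v) (by omega)
    have h1 : T.dist v r = k + 1 := by rw [T.dist_comm]; exact hk
    have hus : T.dist u r < T.dist u s := by
      have := dist_tri hT v u s
      have h2 := dist_eq_one huv.symm
      have h3 : T.dist u r = k := by rw [T.dist_comm]; omega
      omega
    have hwu := ih k (by omega) u (by omega) hus
    -- `z` is the step from `u` towards `w`: across the edge to `s` if `u = r`, otherwise the next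
    -- vertex towards `r`.
    have hne : ∃ z, T.Adj z u ∧ z ≠ v ∧ T.dist w u = T.dist w z + 1 := by
      rcases Nat.eq_zero_or_pos k with rfl | hkp
      · obtain rfl := eq_of_dist_zero hT (show T.dist r u = 0 by omega)
        refine ⟨s, h.symm, ?_, hws⟩
        rintro rfl
        simp at hv
      · obtain ⟨z, hz, hdz⟩ := exists_closer hT (p := r) (w := u) (by omega)
        refine ⟨z, hz, ?_, ?_⟩
        · rintro rfl; omega
        · rw [hwu, ih (k - 1) (by omega) z (by omega) ?_]
          · omega
          · have := dist_tri hT u z s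
            have h2 := dist_eq_one hz.symm
            have h3 : T.dist z r = T.dist r z := T.dist_comm
            have h4 : T.dist u r = T.dist r u := T.dist_comm
            omega
    obtain ⟨z, hz, hzv, hdz⟩ := hne
    rw [dist_of_ne_closer hT hz huv hdz hzv, hwu, add_assoc]

/-- The half-tree of all vertices closer to `b` than to `a`. -/
def halfTree (T : SimpleGraph V) (a b : V) : Set V := {w | T.dist w b < T.dist w a}

theorem notMem_halfTree (hT : T.IsTree) {a b w : V} (h : T.Adj a b) :
    w ∉ halfTree T a b ↔ w ∈ halfTree T b a := by
  simp only [halfTree, mem_ofPred_eq]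
  rcases dist_adj hT w h with h1 | h1 <;> omega

/-- Seen from beyond `s`, both `p` and `q` lie behind `r`, so `dist_across` reduces the comparison
to distances from `r`. -/
theorem halfTree_subset (hT : T.IsTree) {p q r s : V} (hrs : T.Adj r s)
    (hp : T.dist p r < T.dist p s) (hq : T.dist q r < T.dist q s)
    (h : T.dist r q < T.dist r p) : halfTree T r s ⊆ halfTree T p q := by
  intro w hw
  have h1 := dist_across hT hrs hw hp
  have h2 := dist_across hT hrs hw hq
  simp only [halfTree, mem_ofPred_eq]
  omega

/-- The only edge leaving a half-tree is the one that defines it. -/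
theorem eq_of_adj_halfTree (hT : T.IsTree) {a b v w : V} (hab : T.Adj a b) (hvw : T.Adj v w)
    (hv : v ∈ halfTree T b a) (hw : w ∈ halfTree T a b) : v = a ∧ w = b := by
  have h := dist_across hT hab hw hv
  rw [dist_eq_one hvw.symm] at h
  exact ⟨(eq_of_dist_zero hT (by omega)).symm, eq_of_dist_zero hT (by omega)⟩

/-- Points on a geodesic starting at `p` are determined by their distance from `p`. -/
theorem between_unique (hT : T.IsTree) {p v v' w : V}
    (h : T.dist p w = T.dist p v + T.dist v w) (h' : T.dist p w = T.dist p v' + T.dist v' w)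
    (hv : T.dist p v = T.dist p v') : v = v' := by
  suffices ∀ k w, T.dist v w = k → T.dist p w = T.dist p v + T.dist v w →
      T.dist p w = T.dist p v' + T.dist v' w → v = v' from this _ w rfl h h'
  clear h h' w
  intro k
  induction k with
  | zero =>
    intro w hk h h'
    rw [eq_of_dist_zero hT hk, eq_of_dist_zero hT (show T.dist v' w = 0 by omega)]
  | succ k ih =>
    intro w hk h h'
    obtain ⟨u, hu, hdu⟩ := exists_closer hT (p := v) (w := w) (by omega)
    obtain ⟨u', hu', hdu'⟩ := exists_closer hT (p := v') (w := w) (by omega)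
    have h1 := dist_tri hT p v u
    have h1' := dist_tri hT p v' u'
    have h2 : T.dist p w = T.dist p u + 1 := by
      rcases dist_adj hT p hu with h3 | h3 <;> omega
    have h2' : T.dist p w = T.dist p u' + 1 := by
      rcases dist_adj hT p hu' with h3 | h3 <;> omega
    obtain rfl := closer_unique hT hu hu' h2 h2'
    exact ih u (by omega) (by omega) (by omega)

theorem exists_between (hT : T.IsTree) {a b : V} {k l : ℕ} (h : T.dist a b = k + l) :
    ∃ z, T.dist a z = k ∧ T.dist z b = l := by
  induction l generalizing b with
  | zero => exact ⟨b, h, by simp⟩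
  | succ l ih =>
    obtain ⟨u, hu, hdu⟩ := exists_closer hT (p := a) (w := b) (by omega)
    obtain ⟨z, hz, hzu⟩ := ih (b := u) (by omega)
    refine ⟨z, hz, ?_⟩
    have h1 := dist_tri hT a z b
    rcases dist_adj hT z hu with h3 | h3 <;> omega

end TreeGeometry

/-! ### Types and the supply of neighbours and rays in a semiregular tree. -/

section Semiregular

variable {V : Type*} {T : SimpleGraph V} {d : Fin 2 → ℕ} {type : V → Fin 2}

theorem neighborSet_finite (hT : IsSemiregularTree T d type) (hd : ∀ t, 4 ≤ d t) (v : V) :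
    (T.neighborSet v).Finite := by
  apply Set.finite_of_ncard_ne_zero
  rw [hT.ncard_neighborSet]
  have := hd (type v)
  omega

/-- Any three vertices miss some neighbour of `v`. -/
theorem exists_neighbor (hT : IsSemiregularTree T d type) (hd : ∀ t, 4 ≤ d t) (v a b c : V) :
    ∃ w, T.Adj v w ∧ w ≠ a ∧ w ≠ b ∧ w ≠ c := by
  have h : ({a, b, c} : Set V).ncard < (T.neighborSet v).ncard := by
    rw [hT.ncard_neighborSet]
    have h1 := Set.ncard_insert_le a {b, c}
    have h2 := Set.ncard_insert_le b {c}
    rw [Set.ncard_singleton] at h2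
    have := hd (type v)
    omega
  obtain ⟨w, hw, hw'⟩ := Set.exists_mem_notMem_of_ncard_lt_ncard h (by simp)
  simp only [mem_insert_iff, mem_singleton_iff, not_or] at hw'
  exact ⟨w, hw, hw'⟩

theorem type_eq_iff_even (hT : IsSemiregularTree T d type) (v w : V) :
    type v = type w ↔ Even (T.dist v w) := by
  suffices ∀ k w, T.dist v w = k → (type v = type w ↔ Even k) from this _ w rfl
  intro k
  induction k with
  | zero =>
    intro w h
    simp [eq_of_dist_zero hT.isTree h]
  | succ k ih =>
    intro w h
    obtain ⟨u, hu, hdu⟩ := exists_closer hT.isTree (p := v) (w := w) (by omega)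
    have h1 := hT.type_ne hu
    rw [Nat.even_add_one, ← ih u (by omega)]
    omega

theorem type_val (hT : IsSemiregularTree T d type) (v w : V) :
    (type w : ℕ) = (type v + T.dist v w) % 2 := by
  have h := type_eq_iff_even hT v w
  have h1 := (type v).2
  have h2 := (type w).2
  rw [Fin.ext_iff] at h
  rcases Nat.even_or_odd (T.dist v w) with he | he
  · have := h.2 he
    obtain ⟨k, hk⟩ := he
    omega
  · have h3 := mt h.1 (Nat.not_even_iff_odd.2 he)
    obtain ⟨k, hk⟩ := he
    omega

/-- One can move away from `v` by `m` steps, going away from both `x` and `p`. -/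
theorem exists_away (hT : IsSemiregularTree T d type) (hd : ∀ t, 4 ≤ d t) (v x p : V) (m : ℕ) :
    ∃ w, T.dist v w = m ∧ T.dist x w = T.dist x v + m ∧ T.dist p w = T.dist p v + m := by
  induction m with
  | zero => exact ⟨v, by simp, by simp, by simp⟩
  | succ m ih =>
    obtain ⟨w, h1, h2, h3⟩ := ih
    -- Each of `v`, `x`, `p` excludes at most one neighbour of `w`, so one of the at least four
    -- neighbours remains.
    have key : ∀ q, ∃ a, ∀ z, T.Adj w z → z ≠ a → T.dist q z = T.dist q w + 1 := by
      intro q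
      by_cases hq : T.dist q w = 0
      · refine ⟨q, fun z hz _ => ?_⟩
        obtain rfl := eq_of_dist_zero hT.isTree hq
        rw [hq, dist_eq_one hz]
      · obtain ⟨u, hu, hdu⟩ := exists_closer hT.isTree hq
        exact ⟨u, fun z hz hza => dist_of_ne_closer hT.isTree hu hz hdu hza.symm⟩
    obtain ⟨a, ha⟩ := key v
    obtain ⟨b, hb⟩ := key x
    obtain ⟨c, hc⟩ := key p
    obtain ⟨z, hz, hza, hzb, hzc⟩ := exists_neighbor hT hd w a b c
    exact ⟨z, by rw [ha z hz hza, h1], by rw [hb z hz hzb, h2, add_assoc],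
      by rw [hc z hz hzc, h3, add_assoc]⟩

theorem exists_ray (hT : IsSemiregularTree T d type) (hd : ∀ t, 4 ≤ d t) {a b : V}
    (h : T.Adj a b) : ∃ c, NonBacktracking T c ∧ c 0 = a ∧ c 1 = b := by
  have step : ∀ e : V × V, ∃ z, T.Adj e.2 z ∧ z ≠ e.1 := fun e => by
    obtain ⟨z, hz, hz', -⟩ := exists_neighbor hT hd e.2 e.1 e.1 e.1
    exact ⟨z, hz, hz'⟩
  choose f hf hf' using step
  let c : ℕ → V × V := fun n => (fun e : V × V => (e.2, f e))^[n] (a, b)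
  have hc : ∀ n, c (n + 1) = ((c n).2, f (c n)) := fun n =>
    Function.iterate_succ_apply' _ _ _
  have hadj : ∀ n, T.Adj (c n).1 (c n).2 := by
    intro n
    induction n with
    | zero => exact h
    | succ n ih => rw [hc]; exact hf _
  refine ⟨fun n => (c n).1, ⟨fun n => ?_, fun n => ?_⟩, rfl, rfl⟩
  · simp only [hc]; exact hadj n
  · simp only [hc]; exact (hf' _).symm

/-- Prepending a vertex to a non-backtracking path. -/
theorem NonBacktracking.cons {c : ℕ → V} (hc : NonBacktracking T c) {a : V} (h : T.Adj a (c 0))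
    (h' : a ≠ c 1) : NonBacktracking T (fun n => Nat.casesOn n a c) :=
  ⟨fun n => by cases n with
    | zero => exact h
    | succ n => exact hc.1 n, fun n => by cases n with
    | zero => exact h'
    | succ n => exact hc.2 n⟩

/-- Any geodesic segment is contained in a ray. -/
theorem exists_ray_through (hT : IsSemiregularTree T d type) (hd : ∀ t, 4 ≤ d t) (a b : V) :
    ∃ c, NonBacktracking T c ∧ c 0 = a ∧ c (T.dist a b) = b := by
  obtain ⟨z, hz, -⟩ := exists_neighbor hT hd b b b b
  -- The vertex `z` behind `a` is carried along so that the induction can prepend a vertex without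
  -- backtracking.
  suffices ∀ n a z, T.dist a b = n → T.Adj z a → T.dist z b = n + 1 →
      ∃ c, NonBacktracking T c ∧ c 0 = a ∧ c n = b ∧ z ≠ c 1 by
    obtain ⟨z, hz, hd1, -⟩ := exists_away hT hd a b b 1
    obtain ⟨c, hc, h0, h1, -⟩ := this _ a z rfl (SimpleGraph.dist_eq_one_iff_adj.1 hz).symm (by
      rw [T.dist_comm, hd1, T.dist_comm])
    exact ⟨c, hc, h0, h1⟩
  intro n
  induction n with
  | zero =>
    intro a z h hz _
    obtain ⟨y, hy, hyz, -⟩ := exists_neighbor hT hd a z z z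
    obtain ⟨c, hc, h0, h1⟩ := exists_ray hT hd hy
    exact ⟨c, hc, h0, h0.trans (eq_of_dist_zero hT.isTree h), by rw [h1]; exact hyz.symm⟩
  | succ n ih =>
    intro a z h hz hzb
    obtain ⟨u, hu, hdu⟩ := exists_closer hT.isTree (p := b) (w := a) (by rw [T.dist_comm]; omega)
    rw [dist_symm T b a, dist_symm T b u] at hdu
    obtain ⟨c, hc, h0, h1, h2⟩ := ih u a (by omega) hu.symm h
    refine ⟨_, hc.cons (a := a) (by rw [h0]; exact hu.symm) h2, rfl, h1, ?_⟩
    show z ≠ c 0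
    rw [h0]
    rintro rfl
    omega

end Semiregular

end SemiTree

namespace SemiTree

open Set

/-! ### Automorphisms from local data. -/

section Extension

variable {V : Type*} {T : SimpleGraph V}

/-- A locally bijective map of a tree to itself is an automorphism. -/
theorem exists_aut_of_bijOn (hT : T.IsTree) (g : V → V)
    (h : ∀ w, BijOn g (T.neighborSet w) (T.neighborSet (g w))) : ∃ g' : T ≃g T, ⇑g' = g := by
  -- Local injectivity forbids backtracking, so edges leading away from `a` go to edges leading away
  -- from `g a`; injectivity of `g` follows.
  have key : ∀ n a u b, T.Adj u b → T.dist a u = n → T.dist a b = n + 1 →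
      T.dist (g a) (g u) = n ∧ T.dist (g a) (g b) = n + 1 := by
    intro n
    induction n with
    | zero =>
      intro a u b hub hau _
      obtain rfl := eq_of_dist_zero hT hau
      exact ⟨by simp, dist_eq_one ((h a).mapsTo hub)⟩
    | succ n ih =>
      intro a u b hub hau hab
      obtain ⟨v, hv, hdv⟩ := exists_closer hT (p := a) (w := u) (by omega)
      obtain ⟨h1, h2⟩ := ih a v u hv (by omega) hau
      refine ⟨h2, ?_⟩
      have hne : g v ≠ g b := fun he => by
        have := (h u).injOn hv.symm hub he
        subst this
        omega
      have h3 : T.Adj (g v) (g u) := (h v).mapsTo hv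
      have h4 : T.Adj (g u) (g b) := (h u).mapsTo hub
      rw [dist_of_ne_closer hT h3 h4 (by omega) hne, h2]
  have hinj : Function.Injective g := by
    intro a b hab
    by_contra hne
    have h0 : T.dist a b ≠ 0 := fun h0 => hne (eq_of_dist_zero hT h0)
    obtain ⟨u, hu, hdu⟩ := exists_closer hT h0
    have := (key _ a u b hu rfl hdu).2
    rw [hab, T.dist_self] at this
    omega
  have hsurj : Function.Surjective g := by
    obtain ⟨p⟩ := hT.connected.nonempty
    suffices ∀ n y, T.dist (g p) y = n → ∃ x, g x = y from fun y => this _ y rfl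
    intro n
    induction n with
    | zero => exact fun y hy => ⟨p, eq_of_dist_zero hT hy⟩
    | succ n ih =>
      intro y hy
      obtain ⟨u, hu, hdu⟩ := exists_closer hT (p := g p) (w := y) (by omega)
      obtain ⟨x, rfl⟩ := ih u (by omega)
      obtain ⟨z, -, hz⟩ := (h x).surjOn hu
      exact ⟨z, hz⟩
  refine ⟨⟨Equiv.ofBijective g ⟨hinj, hsurj⟩, fun {a b} => ⟨fun hab => ?_, fun hab => ?_⟩⟩, rfl⟩
  · obtain ⟨z, hz, hzb⟩ := (h a).surjOn hab
    rwa [← hinj hzb]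
  · exact (h a).mapsTo hab

/-- Automorphisms of a tree can be constructed by recursion on the distance from a root `p`,
extending at each step a map from a neighbour `u` of `w` to all neighbours of `w`. -/
theorem exists_aut_of_local (hT : T.IsTree) (p q : V) (Q : V → V → Prop)
    (P : V → V → (V → V) → Prop)
    (h0 : Q p q ∧ ∃ f, BijOn f (T.neighborSet p) (T.neighborSet q) ∧ P p q f ∧
      ∀ x, T.Adj p x → Q x (f x))
    (hs : ∀ u w u' w', T.Adj u w → T.dist p w = T.dist p u + 1 → T.Adj u' w' → Q u u' → Q w w' →
      ∃ f, BijOn f (T.neighborSet w) (T.neighborSet w') ∧ f u = u' ∧ P w w' f ∧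
        ∀ x, T.Adj w x → T.dist p x = T.dist p w + 1 → Q x (f x)) :
    ∃ g : T ≃g T, g p = q ∧ ∀ w, Q w (g w) ∧ ∃ f, P w (g w) f ∧ EqOn f g (T.neighborSet w) := by
  classical
  obtain ⟨hQ, f0, hf0, hP0, hQ0⟩ := h0
  have hpar : ∀ w, ∃ u, w ≠ p → T.Adj u w ∧ T.dist p w = T.dist p u + 1 := by
    intro w
    by_cases hw : w = p
    · exact ⟨p, fun h => (h hw).elim⟩
    · obtain ⟨u, hu⟩ := exists_closer hT (p := p) (w := w)
        (fun h => hw (eq_of_dist_zero hT h).symm)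
      exact ⟨u, fun _ => hu⟩
  choose par hpar using hpar
  have hstep : ∀ u w u' w', ∃ f, T.Adj u w → T.dist p w = T.dist p u + 1 → T.Adj u' w' → Q u u' →
      Q w w' → BijOn f (T.neighborSet w) (T.neighborSet w') ∧ f u = u' ∧ P w w' f ∧
        ∀ x, T.Adj w x → T.dist p x = T.dist p w + 1 → Q x (f x) := by
    intro u w u' w'
    by_cases h : T.Adj u w ∧ T.dist p w = T.dist p u + 1 ∧ T.Adj u' w' ∧ Q u u' ∧ Q w w'
    · obtain ⟨f, hf⟩ := hs u w u' w' h.1 h.2.1 h.2.2.1 h.2.2.2.1 h.2.2.2.2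
      exact ⟨f, fun _ _ _ _ _ => hf⟩
    · exact ⟨id, fun h1 h2 h3 h4 h5 => (h ⟨h1, h2, h3, h4, h5⟩).elim⟩
  choose stp hstp using hstep
  -- The state at `w` is its image together with a map on its neighbours. The image is read off the
  -- neighbour map of the parent.
  let F : ∀ w, (∀ v, T.dist p v < T.dist p w → V × (V → V)) → V × (V → V) := fun w rec =>
    if h : w = p then (q, f0) else
      let s := rec (par w) (by have := (hpar w h).2; omega)
      (s.2 w, stp (par w) w s.1 (s.2 w))
  let S : V → V × (V → V) := (measure (T.dist p)).wf.fix F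
  have hSp : S p = (q, f0) := by
    show (measure (T.dist p)).wf.fix F p = _
    rw [WellFounded.fix_eq]
    simp [F]
  have hSw : ∀ w, w ≠ p →
      S w = ((S (par w)).2 w, stp (par w) w (S (par w)).1 ((S (par w)).2 w)) := by
    intro w hw
    show (measure (T.dist p)).wf.fix F w = _
    rw [WellFounded.fix_eq]
    simp only [F, hw, dite_false]
    rfl
  have inv : ∀ n w, T.dist p w = n → Q w (S w).1 ∧
      BijOn (S w).2 (T.neighborSet w) (T.neighborSet (S w).1) ∧ P w (S w).1 (S w).2 ∧
      (∀ x, T.Adj w x → T.dist p x = T.dist p w + 1 → Q x ((S w).2 x)) ∧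
      (w ≠ p → (S w).2 (par w) = (S (par w)).1) := by
    intro n
    induction n with
    | zero =>
      intro w hw
      obtain rfl := eq_of_dist_zero hT hw
      rw [hSp]
      exact ⟨hQ, hf0, hP0, fun x hx _ => hQ0 x hx, fun h => (h rfl).elim⟩
    | succ n ih =>
      intro w hw
      have hwp : w ≠ p := by
        rintro rfl
        simp at hw
      obtain ⟨h1, h2⟩ := hpar w hwp
      obtain ⟨i1, i2, -, i4, -⟩ := ih (par w) (by omega)
      obtain ⟨j1, j2, j3, j4⟩ := hstp (par w) w (S (par w)).1 ((S (par w)).2 w) h1 h2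
        (i2.mapsTo h1) i1 (i4 w h1 h2)
      rw [hSw w hwp]
      exact ⟨i4 w h1 h2, j1, j3, j4, fun _ => j2⟩
  have heq : ∀ w, EqOn (S w).2 (fun x => (S x).1) (T.neighborSet w) := by
    intro w x hx
    have hx : T.Adj w x := hx
    rcases dist_adj hT p hx with h | h
    · have hxp : x ≠ p := by
        rintro rfl
        simp at h
      obtain ⟨h1, h2⟩ := hpar x hxp
      obtain rfl := closer_unique hT h1 hx h2 h
      exact (congrArg Prod.fst (hSw x hxp)).symm
    · have hwp : w ≠ p := by
        rintro rfl
        simp at h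
      obtain ⟨h1, h2⟩ := hpar w hwp
      obtain rfl := closer_unique hT h1 hx.symm h2 h
      exact (inv _ w rfl).2.2.2.2 hwp
  obtain ⟨g, hg⟩ := exists_aut_of_bijOn hT (fun w => (S w).1) fun w =>
    ((inv _ w rfl).2.1).congr (heq w)
  refine ⟨g, by rw [hg]; exact congrArg Prod.fst hSp, fun w => ?_⟩
  rw [hg]
  exact ⟨(inv _ w rfl).1, (S w).2, (inv _ w rfl).2.2.1, heq w⟩

end Extension

/-! ### Local maps of given signature. -/

section LocalSign

variable {V : Type*} {T : SimpleGraph V} {d : Fin 2 → ℕ} {type : V → Fin 2} {i : V → ℕ}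

/-- `f` induces on the colors of the neighbours of `w` a permutation of signature `ε`. -/
def LocalSign (T : SimpleGraph V) (d : Fin 2 → ℕ) (type : V → Fin 2) (i : V → ℕ) (f : V → V)
    (w : V) (ε : ℤˣ) : Prop :=
  ∃ π : Equiv.Perm (Icc 1 (d (type w))),
    (∀ x, T.Adj w x → ∀ c : Icc 1 (d (type w)), (c : ℕ) = i x → (π c : ℕ) = i (f x)) ∧
      Equiv.Perm.sign π = ε

theorem LocalSign.sgn_eq (hi : IsLegalColoring T d type i) {f : V → V} {w : V} {ε : ℤˣ}
    (h : LocalSign T d type i f w ε) {g : T ≃g T} (hg : EqOn f g (T.neighborSet w)) :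
    sgn hi g w = ε := by
  obtain ⟨π, hπ, rfl⟩ := h
  rw [sgn]
  congr 1
  ext c
  obtain ⟨x, rfl⟩ := (Set.BijOn.equiv i (hi w)).surjective c
  rw [hπ x.1 x.2 _ rfl, hg x.2]
  simp only [localAction, Equiv.trans_apply, Equiv.symm_apply_apply]
  rfl

theorem localSign_sgn (hi : IsLegalColoring T d type i) (g : T ≃g T) (w : V) :
    LocalSign T d type i g w (sgn hi g w) := by
  refine ⟨localAction hi g w, fun x hx c hc => ?_, rfl⟩
  obtain rfl : c = Set.BijOn.equiv i (hi w) ⟨x, hx⟩ := Subtype.ext hc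
  simp only [localAction, Equiv.trans_apply, Equiv.symm_apply_apply]
  rfl

theorem sgn_congr (hi : IsLegalColoring T d type i) {g h : T ≃g T} {w : V}
    (hgh : ∀ x, T.Adj w x → g x = h x) : sgn hi g w = sgn hi h w :=
  (localSign_sgn hi h w).sgn_eq hi fun x hx => (hgh x hx).symm

/-- A partially defined permutation leaving two points free extends to permutations of both
signatures. -/
theorem exists_perm_sign {α : Type*} [Fintype α] [DecidableEq α] (hα : 4 ≤ Fintype.card α)
    (E : Set α) (a b : α) (hE : E ⊆ {a, b}) (φ : α → α) (hφ : InjOn φ E) (ε : ℤˣ) :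
    ∃ π : Equiv.Perm α, EqOn π φ E ∧ Equiv.Perm.sign π = ε := by
  obtain ⟨g, hg⟩ := Set.MapsTo.exists_equiv_extend_of_card_eq (t := (Finset.univ : Finset α)) rfl
    (s := E) (f := φ) (fun x _ => by simp) hφ
  let π : Equiv.Perm α := g.trans (Equiv.subtypeUnivEquiv fun x => Finset.mem_univ x)
  have hπ : EqOn π φ E := hg
  by_cases h : Equiv.Perm.sign π = ε
  · exact ⟨π, hπ, h⟩
  -- Four points leave room for a transposition avoiding `a` and `b`, which corrects a wrong
  -- signature.
  have hc : 1 < (Finset.univ \ {a, b} : Finset α).card := by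
    have h1 := Finset.le_card_sdiff ({a, b} : Finset α) Finset.univ
    have h2 := Finset.card_le_two (a := a) (b := b)
    rw [Finset.card_univ] at h1
    omega
  obtain ⟨x, hx, y, hy, hxy⟩ := Finset.one_lt_card.1 hc
  simp only [Finset.mem_sdiff, Finset.mem_univ, true_and, Finset.mem_insert,
    Finset.mem_singleton, not_or] at hx hy
  refine ⟨π * Equiv.swap x y, fun z hz => ?_, ?_⟩
  · rw [Equiv.Perm.mul_apply, Equiv.swap_apply_of_ne_of_ne, hπ hz]
    · rintro rfl
      rcases hE hz with h | h
      exacts [hx.1 h, hx.2 h]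
    · rintro rfl
      rcases hE hz with h | h
      exacts [hy.1 h, hy.2 h]
  · rw [Equiv.Perm.sign_mul, Equiv.Perm.sign_swap hxy]
    rcases Int.units_eq_one_or ε with rfl | rfl <;>
      rcases Int.units_eq_one_or (Equiv.Perm.sign π) with h' | h' <;> simp_all

/-- The coloring identifies both neighbourhoods with the same set of colors, where
`exists_perm_sign` applies. -/
theorem exists_local (hd : ∀ t, 4 ≤ d t) (hi : IsLegalColoring T d type i) {w w' : V}
    (hw : type w' = type w) (E : Set V) (hEN : E ⊆ T.neighborSet w) (a b : V) (hE : E ⊆ {a, b})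
    (φ : V → V) (hφ : InjOn φ E) (hφ' : MapsTo φ E (T.neighborSet w')) (ε : ℤˣ) :
    ∃ f, BijOn f (T.neighborSet w) (T.neighborSet w') ∧ EqOn f φ E ∧
      LocalSign T d type i f w ε := by
  classical
  have hw' : BijOn i (T.neighborSet w') (Icc 1 (d (type w))) := hw ▸ hi w'
  let e := Set.BijOn.equiv i (hi w)
  let e' := Set.BijOn.equiv i hw'
  have he : ∀ c, i (e.symm c).1 = c := fun c => congrArg Subtype.val (e.apply_symm_apply c)
  let ψ : Icc 1 (d (type w)) → Icc 1 (d (type w)) := fun c =>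
    if h : (e.symm c).1 ∈ E then e' ⟨φ (e.symm c).1, hφ' h⟩ else c
  have h1 : 1 ∈ Icc 1 (d (type w)) := ⟨le_rfl, (by norm_num : 1 ≤ 4).trans (hd _)⟩
  -- The default color is harmless: `col a` and `col b` only bound the set of constrained colors,
  -- and those come from actual neighbours.
  let col : V → Icc 1 (d (type w)) := fun v =>
    if h : i v ∈ Icc 1 (d (type w)) then ⟨i v, h⟩ else ⟨1, h1⟩
  have hcol : ∀ c, col (e.symm c).1 = c := by
    intro c
    apply Subtype.ext
    simp only [col, he]
    rw [dif_pos c.2]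
  obtain ⟨π, hπ, hs⟩ := exists_perm_sign (α := Icc 1 (d (type w))) (by simpa using hd (type w))
    {c | (e.symm c).1 ∈ E} (col a) (col b) (fun c hc => by
      rcases hE hc with h | h
      · exact Or.inl (by rw [← h, hcol])
      · exact Or.inr (by rw [← mem_singleton_iff.1 h, hcol]; rfl)) ψ (fun c hc c' hc' h => by
      have hc : (e.symm c).1 ∈ E := hc
      have hc' : (e.symm c').1 ∈ E := hc'
      simp only [ψ, dif_pos hc, dif_pos hc'] at h
      have h2 := hφ hc hc' (congrArg Subtype.val (e'.injective h))
      exact e.symm.injective (Subtype.ext h2)) ε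
  let G : T.neighborSet w ≃ T.neighborSet w' := (e.trans π).trans e'.symm
  let f : V → V := fun x => if h : x ∈ T.neighborSet w then G ⟨x, h⟩ else x
  have hf : ∀ x (hx : x ∈ T.neighborSet w), f x = G ⟨x, hx⟩ := fun x hx => dif_pos hx
  refine ⟨f, ⟨fun x hx => ?_, fun x hx y hy hxy => ?_, fun y hy => ?_⟩, fun x hx => ?_, π,
    fun x hx c hc => ?_, hs⟩
  · rw [hf x hx]
    exact (G ⟨x, hx⟩).2
  · rw [hf x hx, hf y hy] at hxy
    exact congrArg Subtype.val (G.injective (Subtype.ext hxy))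
  · refine ⟨(G.symm ⟨y, hy⟩).1, (G.symm ⟨y, hy⟩).2, ?_⟩
    rw [hf _ (G.symm ⟨y, hy⟩).2]
    simp
  · have hxN := hEN hx
    rw [hf x hxN]
    have h2 : e.symm (e ⟨x, hxN⟩) = ⟨x, hxN⟩ := e.symm_apply_apply _
    have h3 : π (e ⟨x, hxN⟩) = e' ⟨φ x, hφ' hx⟩ := by
      rw [hπ (show (e.symm (e ⟨x, hxN⟩)).1 ∈ E by rw [h2]; exact hx)]
      simp only [ψ, h2, dif_pos hx]
    simp only [G, Equiv.trans_apply, h3, Equiv.symm_apply_apply]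
  · have hc : c = e ⟨x, hx⟩ := Subtype.ext hc
    rw [hf x hx, hc]
    have : e' (G ⟨x, hx⟩) = π (e ⟨x, hx⟩) := by simp [G]
    rw [← this]
    rfl

end LocalSign

/-! ### Extending partial automorphisms with prescribed signatures. -/

section Prescribed

variable {V : Type*} {T : SimpleGraph V} {d : Fin 2 → ℕ} {type : V → Fin 2} {i : V → ℕ}

theorem type_eq_of_adj (hT : IsSemiregularTree T d type) {u v u' v' : V} (h : T.Adj u v)
    (h' : T.Adj u' v') (hu : type u' = type u) : type v' = type v := by
  have h1 := hT.type_ne h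
  have h2 := hT.type_ne h'
  omega

/-- Extension of a partial automorphism, defined on a subtree `D`, to a type-preserving
automorphism with prescribed signatures of the local actions. -/
theorem exists_aut_extending (hd : ∀ t, 4 ≤ d t) (hT : IsSemiregularTree T d type)
    (hi : IsLegalColoring T d type i) (p : V) (D : Set V) (hp : p ∈ D) (g₀ : V → V)
    (htype : ∀ w ∈ D, type (g₀ w) = type w)
    (hadj : ∀ u ∈ D, ∀ w ∈ D, T.Adj u w → T.Adj (g₀ u) (g₀ w))
    (hinj : ∀ w ∈ D, InjOn g₀ (T.neighborSet w ∩ D))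
    (hD : ∀ u w, T.Adj u w → T.dist p w = T.dist p u + 1 → w ∈ D → u ∈ D) (s : V → ℤˣ)
    (hloc : ∀ w ∈ D, (∃ h : T ≃g T, g₀ w = h w ∧ EqOn g₀ h (T.neighborSet w) ∧
      sgn hi h w = s w) ∨ ∃ a b, T.neighborSet w ∩ D ⊆ {a, b}) :
    ∃ g ∈ autPlus T type, (∀ w ∈ D, g w = g₀ w) ∧ ∀ w, sgn hi g w = s w := by
  -- Where `g₀` is locally an automorphism with the right signature, it is kept. Elsewhere at most
  -- two images are prescribed, and `exists_local` sets the signature.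
  have key : ∀ w ∈ D, ∃ f, BijOn f (T.neighborSet w) (T.neighborSet (g₀ w)) ∧
      LocalSign T d type i f w (s w) ∧ EqOn f g₀ (T.neighborSet w ∩ D) := by
    intro w hw
    rcases hloc w hw with ⟨h, h1, h2, h3⟩ | ⟨a, b, hab⟩
    · refine ⟨h, ?_, h3 ▸ localSign_sgn hi h w, fun x hx => (h2 hx.1).symm⟩
      rw [h1]
      exact ⟨fun x hx => h.map_adj_iff.2 hx, h.injective.injOn, fun y hy =>
        ⟨h.symm y, (h.map_adj_iff).1 (by rw [h.apply_symm_apply]; exact hy), h.apply_symm_apply y⟩⟩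
    · obtain ⟨f, h1, h2, h3⟩ := exists_local hd hi (htype w hw) _ inter_subset_left a b hab g₀
        (hinj w hw) (fun x hx => hadj w hw x hx.2 hx.1) (s w)
      exact ⟨f, h1, h3, h2⟩
  have htp : ∀ {w w' x : V} {f : V → V}, BijOn f (T.neighborSet w) (T.neighborSet w') →
      T.Adj w x → type w' = type w → type (f x) = type x := fun {w w' x f} hf hx hw =>
    type_eq_of_adj hT hx (hf.mapsTo hx) hw
  obtain ⟨g, -, hg⟩ := exists_aut_of_local hT.isTree p (g₀ p)
    (fun w w' => type w' = type w ∧ (w ∈ D → w' = g₀ w))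
    (fun w _ f => LocalSign T d type i f w (s w)) ⟨⟨htype p hp, fun _ => rfl⟩, by
      obtain ⟨f, h1, h2, h3⟩ := key p hp
      exact ⟨f, h1, h2, fun x hx => ⟨htp h1 hx (htype p hp), fun hxD => h3 ⟨hx, hxD⟩⟩⟩⟩ (by
      intro u w u' w' huw hdw huw' hu hw
      by_cases hwD : w ∈ D
      · obtain rfl := hw.2 hwD
        have huD := hD u w huw hdw hwD
        obtain rfl := hu.2 huD
        obtain ⟨f, h1, h2, h3⟩ := key w hwD
        exact ⟨f, h1, h3 ⟨huw.symm, huD⟩, h2, fun x hx _ =>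
          ⟨htp h1 hx hw.1, fun hxD => h3 ⟨hx, hxD⟩⟩⟩
      · obtain ⟨f, h1, h2, h3⟩ := exists_local hd hi hw.1 {u} (by simpa using huw.symm) u u
          (by simp) (fun _ => u') (by simp) (fun _ _ => huw'.symm) (s w)
        exact ⟨f, h1, h2 rfl, h3, fun x hx hdx =>
          ⟨htp h1 hx hw.1, fun hxD => (hwD (hD w x hx hdx hxD)).elim⟩⟩)
  refine ⟨g, fun v => (hg v).1.1, fun w hw => (hg w).1.2 hw, fun w => ?_⟩
  obtain ⟨-, f, h1, h2⟩ := hg w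
  exact h1.sgn_eq hi h2

/-- A vertex on the bounding sphere has at most one neighbour in the ball, so `h` forces only the
signatures at distance less than `m`. -/
theorem exists_aut_extending_ball (hd : ∀ t, 4 ≤ d t) (hT : IsSemiregularTree T d type)
    (hi : IsLegalColoring T d type i) {h : T ≃g T} (hh : h ∈ autPlus T type) (p : V) (m : ℕ)
    (s : V → ℤˣ) (hs : ∀ w, T.dist p w < m → s w = sgn hi h w) :
    ∃ g ∈ autPlus T type, (∀ w, T.dist p w ≤ m → g w = h w) ∧ ∀ w, sgn hi g w = s w := by
  refine exists_aut_extending hd hT hi p {w | T.dist p w ≤ m} (by simp) h (fun w _ => hh w)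
    (fun u _ w _ huw => h.map_adj_iff.2 huw) (fun w _ => h.injective.injOn)
    (fun u w _ h1 h2 => by simp only [mem_ofPred_eq] at *; omega) s fun w hw => ?_
  simp only [mem_ofPred_eq] at hw
  rcases hw.lt_or_eq with hw | hw
  · exact Or.inl ⟨h, rfl, fun _ _ => rfl, (hs w hw).symm⟩
  · right
    by_cases h0 : T.dist p w = 0
    · refine ⟨p, p, fun x hx => ?_⟩
      obtain rfl := eq_of_dist_zero hT.isTree h0
      have h1 := dist_eq_one (show T.Adj p x from hx.1)
      have h2 : T.dist p x ≤ m := hx.2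
      omega
    · obtain ⟨u, hu, hdu⟩ := exists_closer hT.isTree h0
      refine ⟨u, u, fun x hx => Or.inl ?_⟩
      by_contra hne
      have h1 := dist_of_ne_closer hT.isTree hu (show T.Adj w x from hx.1) hdu (Ne.symm hne)
      have h2 : T.dist p x ≤ m := hx.2
      omega

/-- A vertex of a line has just two neighbours on it, so its signature can still be chosen. -/
theorem exists_aut_line (hd : ∀ t, 4 ≤ d t) (hT : IsSemiregularTree T d type)
    (hi : IsLegalColoring T d type i) {l l' : ℤ → V} (hl : IsLine T l) (hl' : IsLine T l')
    (h0 : type (l' 0) = type (l 0)) :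
    ∃ g ∈ autPlus T type, (∀ n, g (l n) = l' n) ∧ ∀ w, sgn hi g w = 1 := by
  have hinj := hl.injective hT.isTree
  have hinj' := hl'.injective hT.isTree
  let g₀ : V → V := Function.extend l l' id
  have hg : ∀ n, g₀ (l n) = l' n := fun n => hinj.extend_apply l' id n
  have hadj : ∀ m n, T.Adj (l m) (l n) → n = m + 1 ∨ n = m - 1 := fun m n h => by
    have := dist_eq_one h
    rw [hl.dist hT.isTree] at this
    omega
  obtain ⟨g, hg1, hg2, hg3⟩ := exists_aut_extending hd hT hi (l 0) (range l) ⟨0, rfl⟩ g₀ (by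
      rintro _ ⟨n, rfl⟩
      have h1 := type_val hT (l 0) (l n)
      have h2 := type_val hT (l' 0) (l' n)
      rw [hl.dist hT.isTree] at h1
      rw [hl'.dist hT.isTree, h0] at h2
      rw [hg]
      exact Fin.ext (h2.trans h1.symm)) (by
      rintro _ ⟨m, rfl⟩ _ ⟨n, rfl⟩ h
      rw [hg, hg]
      rcases hadj m n h with rfl | rfl
      · exact hl'.1 m
      · have := hl'.1 (m - 1)
        rw [sub_add_cancel] at this
        exact this.symm) (by
      rintro _ - _ ⟨-, m, rfl⟩ _ ⟨-, n, rfl⟩ h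
      rw [hg, hg] at h
      rw [hinj' h]) (by
      rintro u _ h hdist ⟨n, rfl⟩
      rw [hl.dist hT.isTree] at hdist
      have key : ∀ m : ℤ, T.Adj (l m) (l n) → (n - 0).natAbs = (m - 0).natAbs + 1 →
          u ∈ range l := fun m h1 h2 => by
        rw [closer_unique hT.isTree h h1 (p := l 0) (by rwa [hl.dist hT.isTree])
          (by rw [hl.dist hT.isTree, hl.dist hT.isTree, h2])]
        exact ⟨m, rfl⟩
      rcases lt_or_ge 0 n with hn | hn
      · refine key (n - 1) ?_ (by omega)
        have := hl.1 (n - 1)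
        rwa [sub_add_cancel] at this
      · exact key (n + 1) (hl.1 n).symm (by omega)) (fun _ => 1) (by
      rintro _ ⟨m, rfl⟩
      refine Or.inr ⟨l (m + 1), l (m - 1), ?_⟩
      rintro _ ⟨h, n, rfl⟩
      rcases hadj m n h with rfl | rfl
      · exact Or.inl rfl
      · exact Or.inr rfl)
  exact ⟨g, hg1, fun n => by rw [hg2 _ ⟨n, rfl⟩, hg], hg3⟩

end Prescribed

end SemiTree

namespace SemiTree

open Set

/-! ### Solving the sign equations. -/

section Signs

/-- Triangular systems of sign equations are solvable: each equation `c` has a pivot variable `π c`,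
and all its other variables come before the pivot. -/
theorem exists_signs {ι V : Type*} (J : Set ι) (S : ι → Finset V) (π : ι → V) (rk : V → ℕ)
    (hinj : InjOn π J) (hmem : ∀ c ∈ J, π c ∈ S c)
    (hlt : ∀ c ∈ J, ∀ w ∈ S c, w ≠ π c → rk w < rk (π c)) (s₀ : V → ℤˣ) (rhs : ι → ℤˣ) :
    ∃ s : V → ℤˣ, (∀ w, w ∉ π '' J → s w = s₀ w) ∧ ∀ c ∈ J, ∏ w ∈ S c, s w = rhs c := by
  classical
  -- A pivot's value is solved for from values of smaller rank, and all other variables keep `s₀`.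
  -- The inner default 1 is never reached.
  let F : ∀ w, (∀ v, rk v < rk w → ℤˣ) → ℤˣ := fun w rec =>
    if h : ∃ c ∈ J, π c = w then
      rhs h.choose * (∏ v ∈ (S h.choose).erase w, if hv : rk v < rk w then rec v hv else 1)⁻¹
    else s₀ w
  let s : V → ℤˣ := (measure rk).wf.fix F
  have hs : ∀ w, s w = F w fun v _ => s v := fun w => (measure rk).wf.fix_eq F w
  refine ⟨s, fun w hw => ?_, fun c hc => ?_⟩
  · rw [hs]
    exact dif_neg hw
  · have h : ∃ c' ∈ J, π c' = π c := ⟨c, hc, rfl⟩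
    have hch : h.choose = c := hinj h.choose_spec.1 hc h.choose_spec.2
    rw [← Finset.mul_prod_erase _ _ (hmem c hc), hs (π c)]
    simp only [F]
    rw [dif_pos h, hch, mul_assoc, mul_eq_left]
    rw [Finset.prod_congr rfl (g := s), inv_mul_cancel]
    intro v hv
    rw [Finset.mem_erase] at hv
    rw [dif_pos (hlt c hc v hv.2 hv.1)]

variable {V : Type*} {T : SimpleGraph V} {d : Fin 2 → ℕ} {type : V → Fin 2} {i : V → ℕ}

/-- The largest radius of a set of radii. -/
abbrev maxRadius (Y : Finset ℕ) : ℕ := Y.sup id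

theorem le_maxRadius {Y : Finset ℕ} {n : ℕ} (h : n ∈ Y) : n ≤ maxRadius Y :=
  Finset.le_sup (f := id) h

theorem maxRadius_mem {Y : Finset ℕ} (h : Y.Nonempty) : maxRadius Y ∈ Y := by
  obtain ⟨n, hn, he⟩ := Y.exists_mem_eq_sup h id
  rw [maxRadius, he]
  exact hn

/-- The vertex `v` is one at which the condition for `t` is imposed. -/
def Relevant (type : V → Fin 2) (Y : Fin 2 → Finset ℕ) (t : Fin 2) (v : V) : Prop :=
  (type v : ℕ) = ((t : ℕ) + maxRadius (Y t)) % 2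

/-- This is the purpose of the parity condition: the outermost vertices of a sphere reveal `t`, so
equations for different `t` never compete for a pivot. -/
theorem Relevant.type_eq (hT : IsSemiregularTree T d type) {Y : Fin 2 → Finset ℕ} {t : Fin 2}
    {v w : V} (h : Relevant type Y t v) (hw : T.dist v w = maxRadius (Y t)) : type w = t := by
  have h1 := type_val hT v w
  rw [Relevant] at h
  have := t.2
  apply Fin.ext
  omega

/-- Sign functions with prescribed products over the spheres `S_{Y t}(v)` and prescribed values on a
set `D`, provided each of the equations holds on `D` already, or involves an outermost vertex
(as seen from a root `p`) that does not lie in `D`. -/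
theorem exists_signs_spheres (hT : IsSemiregularTree T d type) (hi : IsLegalColoring T d type i)
    (Y : Fin 2 → Finset ℕ) (p : V) (D : Set V) (s₀ : V → ℤˣ) (c : Fin 2 → V → ℤˣ)
    (h : ∀ t v, (Y t).Nonempty → Relevant type Y t v →
      (spheres T (Y t) v ⊆ D ∧ ∏ᶠ w ∈ spheres T (Y t) v, s₀ w = c t v) ∨
      ∃ w, w ∉ D ∧ T.dist v w = maxRadius (Y t) ∧ T.dist p w = T.dist p v + maxRadius (Y t)) :
    ∃ s : V → ℤˣ, (∀ w ∈ D, s w = s₀ w) ∧ ∀ t v, (Y t).Nonempty → Relevant type Y t v →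
      ∏ᶠ w ∈ spheres T (Y t) v, s w = c t v := by
  classical
  let good : Fin 2 × V → V → Prop := fun tv w => w ∉ D ∧ T.dist tv.2 w = maxRadius (Y tv.1) ∧
    T.dist p w = T.dist p tv.2 + maxRadius (Y tv.1)
  let J : Set (Fin 2 × V) := {tv | (Y tv.1).Nonempty ∧ Relevant type Y tv.1 tv.2 ∧ ∃ w, good tv w}
  have hπ : ∀ tv, ∃ w, tv ∈ J → good tv w := by
    intro tv
    by_cases htv : tv ∈ J
    · exact ⟨htv.2.2.choose, fun _ => htv.2.2.choose_spec⟩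
    · exact ⟨tv.2, fun h => (htv h).elim⟩
  choose π hπ using hπ
  let S : Fin 2 × V → Finset V := fun tv => (spheres_finite hT hi (Y tv.1) tv.2).toFinset
  have hS : ∀ tv w, w ∈ S tv ↔ T.dist tv.2 w ∈ Y tv.1 := fun tv w => by
    simp only [S, Set.Finite.mem_toFinset]
    rfl
  have hprod : ∀ (f : V → ℤˣ) (tv : Fin 2 × V),
      ∏ᶠ w ∈ spheres T (Y tv.1) tv.2, f w = ∏ w ∈ S tv, f w := fun f tv =>
    finprod_mem_eq_finite_toFinset_prod f _
  -- A pivot determines its equation: its type is `t`, and the centre is the point at distance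
  -- `maxRadius (Y t)` before it on the geodesic from `p`.
  have hdet : ∀ tv ∈ J, ∀ w, T.dist tv.2 w = maxRadius (Y tv.1) →
      T.dist p w = T.dist p tv.2 + maxRadius (Y tv.1) → ∀ tv' ∈ J, π tv' = w → tv' = tv := by
    intro tv htv w h1 h2 tv' htv' hw
    obtain ⟨-, h3, h4⟩ := hπ tv' htv'
    rw [hw] at h3 h4
    have ht : tv'.1 = tv.1 := (htv'.2.1.type_eq hT h3).symm.trans (htv.2.1.type_eq hT h1)
    rw [ht] at h3 h4
    exact Prod.ext ht (between_unique hT.isTree (p := p) (w := w) (by omega) (by omega) (by omega))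
  obtain ⟨s, hs1, hs2⟩ := exists_signs J S π
    -- Several vertices of a sphere may be outermost. By `hdet` only the chosen one is a pivot of
    -- any equation, so the extra 1 breaks the tie.
    (fun w => 2 * T.dist p w + if w ∈ π '' J then 1 else 0)
    (fun tv htv tv' htv' he => by
      obtain ⟨-, h1, h2⟩ := hπ tv' htv'
      exact hdet tv' htv' _ h1 h2 tv htv he)
    (fun tv htv => by
      rw [hS, (hπ tv htv).2.1]
      exact maxRadius_mem htv.1)
    (fun tv htv w hw hne => by
      rw [hS] at hw
      have h1 := le_maxRadius hw
      have h2 := dist_tri hT.isTree p tv.2 w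
      obtain ⟨-, -, h4⟩ := hπ tv htv
      rw [if_pos (mem_image_of_mem π htv)]
      rcases (show T.dist p w ≤ T.dist p (π tv) by omega).lt_or_eq with h5 | h5
      · split_ifs <;> omega
      · rw [if_neg, h5]
        · omega
        · rintro ⟨tv', htv', hw'⟩
          rw [hdet tv htv w (by omega) (by omega) tv' htv' hw'] at hw'
          exact hne hw'.symm)
    s₀ (fun tv => c tv.1 tv.2)
  have hsD : ∀ w ∈ D, s w = s₀ w := fun w hw => hs1 w (by
    rintro ⟨tv, htv, rfl⟩
    exact (hπ tv htv).1 hw)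
  refine ⟨s, hsD, fun t v hY hv => ?_⟩
  rcases h t v hY hv with ⟨h1, h2⟩ | h1
  · rw [← h2]
    exact finprod_mem_congr rfl fun w hw => hsD w (h1 hw)
  · have hJ : (t, v) ∈ J := ⟨hY, hv, h1⟩
    rw [hprod s (t, v), hs2 _ hJ]

end Signs

/-! ### Membership in the group, and closedness. -/

section Groups

variable {V : Type*} {T : SimpleGraph V} {d : Fin 2 → ℕ} {type : V → Fin 2} {i : V → ℕ}

theorem sgnProd_congr (hi : IsLegalColoring T d type i) {g h : T ≃g T} {Y : Finset ℕ} {v : V}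
    (hgh : ∀ w, T.dist v w ≤ maxRadius Y + 1 → g w = h w) : sgnProd hi g Y v = sgnProd hi h Y v := by
  refine finprod_mem_congr rfl fun w hw => sgn_congr hi fun x hx => hgh x ?_
  have h1 : T.dist v w ≤ maxRadius Y := le_maxRadius hw
  have := SimpleGraph.Adj.diff_dist_adj (u := v) (show T.Adj w x from hx)
  omega

theorem mem_GPlus_iff (hT : IsSemiregularTree T d type) (hi : IsLegalColoring T d type i)
    (Y : Fin 2 → Finset ℕ) (g : T ≃g T) : g ∈ GPlus hT hi Y ↔ g ∈ autPlus T type ∧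
      ∀ t v, (Y t).Nonempty → Relevant type Y t v → sgnProd hi g (Y t) v = 1 := by
  refine ⟨fun h => ⟨h.1, fun t v _ hv => h.2 t v hv⟩, fun h => ⟨h.1, fun t v hv => ?_⟩⟩
  rcases (Y t).eq_empty_or_nonempty with h0 | h0
  · simp [sgnProd, spheres, h0]
  · exact h.2 t v h0 hv

/-- Such elements lie in the group for every `Y`; they supply most of the conjugating elements
below. -/
theorem mem_GPlus_of_sgn (hT : IsSemiregularTree T d type) (hi : IsLegalColoring T d type i)
    (Y : Fin 2 → Finset ℕ) {g : T ≃g T} (hg : g ∈ autPlus T type) (h : ∀ v, sgn hi g v = 1) :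
    g ∈ GPlus hT hi Y :=
  ⟨hg, fun t v _ => by simp [sgnProd, h]⟩

/-- An automorphism that agrees on each finite set with an element of the group is in the group. -/
theorem mem_GPlus_of_forall_finite (hT : IsSemiregularTree T d type)
    (hi : IsLegalColoring T d type i) (Y : Fin 2 → Finset ℕ) {g : T ≃g T}
    (h : ∀ s : Set V, s.Finite → ∃ g' ∈ GPlus hT hi Y, ∀ v ∈ s, g' v = g v) :
    g ∈ GPlus hT hi Y := by
  refine ⟨fun v => ?_, fun t v hv => ?_⟩
  · obtain ⟨g', hg', he⟩ := h {v} (finite_singleton v)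
    rw [← he v rfl]
    exact hg'.1 v
  · obtain ⟨g', hg', he⟩ := h _ (spheres_finite hT hi (Finset.range (maxRadius (Y t) + 2)) v)
    rw [← hg'.2 t v hv]
    refine (sgnProd_congr hi fun w hw => he w ?_).symm
    show T.dist v w ∈ Finset.range (maxRadius (Y t) + 2)
    rw [Finset.mem_range]
    omega

theorem isClosed_GPlus (hT : IsSemiregularTree T d type) (hi : IsLegalColoring T d type i)
    (Y : Fin 2 → Finset ℕ) : IsClosed (GPlus hT hi Y : Set (T ≃g T)) := by
  refine isClosed_of_closure_subset fun g hg => mem_GPlus_of_forall_finite hT hi Y fun s hs => ?_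
  have hopen : IsOpen {g' : T ≃g T | ∀ v ∈ s, g' v = g v} := by
    let _ : TopologicalSpace V := ⊥
    have : DiscreteTopology V := ⟨rfl⟩
    have hc : ∀ v, Continuous fun g' : T ≃g T => g' v := fun v =>
      (continuous_apply v).comp continuous_induced_dom
    have : {g' : T ≃g T | ∀ v ∈ s, g' v = g v} =
        ⋂ v ∈ s, (fun g' : T ≃g T => g' v) ⁻¹' {g v} := by
      ext g'
      simp
    rw [this]
    exact hs.isOpen_biInter fun v _ => (isOpen_discrete _).preimage (hc v)
  obtain ⟨g', h1, h2⟩ := mem_closure_iff.1 hg _ hopen fun _ _ => rfl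
  exact ⟨g', h2, h1⟩

end Groups

/-! ### Lines between ends, and 2-transitivity. -/

section Transitivity

variable {V : Type*} {T : SimpleGraph V} {d : Fin 2 → ℕ} {type : V → Fin 2} {i : V → ℕ}

theorem Ray.nonBacktracking (r : Ray T) : NonBacktracking T r.1 :=
  ⟨r.2.1, fun n h => by have := r.2.2 h; omega⟩

/-- The ray given by a non-backtracking path. -/
def NonBacktracking.toRay (hT : T.IsTree) {c : ℕ → V} (h : NonBacktracking T c) : Ray T :=
  ⟨c, h.1, h.injective hT⟩

/-- Each end is represented by a ray starting at a given vertex. -/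
theorem exists_ray_of_end (hT : T.IsTree) (e : Ends T) (p : V) :
    ∃ r : Ray T, (⟦r⟧ : Ends T) = e ∧ r.1 0 = p := by
  induction e using Quotient.inductionOn with
  | _ r =>
  suffices ∀ n p, T.dist (r.1 0) p = n → ∃ r' : Ray T, r' ≈ r ∧ r'.1 0 = p by
    obtain ⟨r', h1, h2⟩ := this _ p rfl
    exact ⟨r', Quotient.sound h1, h2⟩
  intro n
  induction n with
  | zero => exact fun p hp => ⟨r, Setoid.refl r, eq_of_dist_zero hT hp⟩
  | succ n ih =>
    intro p hp
    obtain ⟨u, hu, hdu⟩ := exists_closer hT (p := r.1 0) (w := p) (by omega)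
    obtain ⟨r', h1, h2⟩ := ih u (by omega)
    by_cases hp1 : p = r'.1 1
    · refine ⟨(r'.nonBacktracking.shift 1).toRay hT, Setoid.trans ⟨0, 1, fun k => ?_⟩ h1, hp1.symm⟩
      show r'.1 (1 + (0 + k)) = r'.1 (1 + k)
      rw [zero_add]
    · refine ⟨(r'.nonBacktracking.cons (a := p) (by rw [h2]; exact hu.symm) hp1).toRay hT,
        Setoid.trans ⟨1, 0, fun k => ?_⟩ h1, rfl⟩
      rw [add_comm, zero_add]
      rfl

/-- Two distinct ends are joined by a line, starting at a vertex of a given type. -/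
theorem exists_line_of_ends (hT : IsSemiregularTree T d type) {e e' : Ends T} (h : e ≠ e')
    (t : Fin 2) : ∃ (r s : Ray T) (l : ℤ → V), (⟦r⟧ : Ends T) = e ∧ (⟦s⟧ : Ends T) = e' ∧
      IsLine T l ∧ (∀ n : ℕ, l n = r.1 n) ∧ (∀ n : ℕ, l (-n) = s.1 n) ∧ type (l 0) = t := by
  obtain ⟨p⟩ := hT.isTree.connected.nonempty
  obtain ⟨r, rfl, hr0⟩ := exists_ray_of_end hT.isTree e p
  obtain ⟨s, rfl, hs0⟩ := exists_ray_of_end hT.isTree e' p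
  have hne : ∃ n, r.1 (n + 1) ≠ s.1 (n + 1) := by
    by_contra! hall
    exact h (Quotient.sound ⟨1, 1, fun k => by rw [add_comm]; exact hall k⟩)
  classical
  have hk := Nat.find_spec hne
  set k := Nat.find hne with hkdef
  have hrs : r.1 k = s.1 k := by
    rcases Nat.eq_zero_or_pos k with h0 | h0
    · rw [h0, hr0, hs0]
    · have := Nat.find_min hne (m := k - 1) (by omega)
      rw [not_not, show k - 1 + 1 = k by omega] at this
      exact this
  have shift_equiv : ∀ (r : Ray T) (m : ℕ), (r.nonBacktracking.shift m).toRay hT.isTree ≈ r :=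
    fun r m => ⟨0, m, fun j => by
      show r.1 (m + (0 + j)) = _
      rw [zero_add]⟩
  -- The rays part at index `k`. If that vertex has the wrong type, the base point moves one step
  -- along `r`.
  by_cases ht : type (r.1 k) = t
  · obtain ⟨l, hl, h1, h2⟩ := exists_line_of_rays (r.nonBacktracking.shift k)
      (s.nonBacktracking.shift k) hrs hk
    exact ⟨(r.nonBacktracking.shift k).toRay hT.isTree, (s.nonBacktracking.shift k).toRay hT.isTree,
      l, Quotient.sound (shift_equiv r k), Quotient.sound (shift_equiv s k), hl, h1, h2,
      (congrArg type (h1 0)).trans ht⟩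
  · have hc : NonBacktracking T (fun n => Nat.casesOn n (r.1 (k + 1)) fun n => s.1 (k + n)) :=
      (s.nonBacktracking.shift k).cons (a := r.1 (k + 1)) (by
        have := (r.2.1 k).symm
        rw [hrs] at this
        exact this) hk
    obtain ⟨l, hl, h1, h2⟩ := exists_line_of_rays (r.nonBacktracking.shift (k + 1)) hc rfl (by
      show r.1 (k + 2) ≠ s.1 k
      rw [← hrs]
      exact fun he => by have := r.2.2 he; omega)
    refine ⟨(r.nonBacktracking.shift (k + 1)).toRay hT.isTree, hc.toRay hT.isTree,
      l, Quotient.sound (shift_equiv r (k + 1)), Quotient.sound ⟨1, k, fun j => ?_⟩, hl, h1, h2, ?_⟩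
    · rw [add_comm 1 j]
      rfl
    · have h3 := hT.type_ne (r.2.1 k)
      have h4 : l 0 = r.1 (k + 1) := h1 0
      rw [h4]
      omega

theorem isMultiplyPretransitive_GPlus (hd : ∀ t, 4 ≤ d t) (hT : IsSemiregularTree T d type)
    (hi : IsLegalColoring T d type i) (Y : Fin 2 → Finset ℕ) :
    MulAction.IsMultiplyPretransitive (GPlus hT hi Y) (Ends T) 2 := by
  rw [MulAction.is_two_pretransitive_iff]
  intro a b a' b' hab hab'
  obtain ⟨r, s, l, rfl, rfl, hl, hr, hs, ht⟩ := exists_line_of_ends hT hab 0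
  obtain ⟨r', s', l', rfl, rfl, hl', hr', hs', ht'⟩ := exists_line_of_ends hT hab' 0
  obtain ⟨g, hg, hgl, hsgn⟩ := exists_aut_line hd hT hi hl hl' (ht'.trans ht.symm)
  refine ⟨⟨g, mem_GPlus_of_sgn hT hi Y hg hsgn⟩, ?_, ?_⟩
  · exact Quotient.sound ⟨0, 0, fun n => by
      show g (r.1 (0 + n)) = _
      rw [← hr, ← hr', hgl]⟩
  · exact Quotient.sound ⟨0, 0, fun n => by
      show g (s.1 (0 + n)) = _
      rw [← hs, ← hs', hgl]⟩

end Transitivity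

end SemiTree

namespace SemiTree

open Set Filter

/-! ### Conjugating pairs, limits, and truncation to half-trees. -/

section Lemmas

variable {V : Type*} {T : SimpleGraph V} {d : Fin 2 → ℕ} {type : V → Fin 2} {i : V → ℕ}

theorem sgn_inv_apply (hi : IsLegalColoring T d type i) (g : T ≃g T) (v : V) :
    sgn hi g⁻¹ (g v) = sgn hi g v := by
  have h := sgn_mul hi g⁻¹ g v
  rw [inv_mul_cancel, sgn_one] at h
  rw [← Int.units_inv_eq_self (sgn hi g v)]
  exact eq_inv_of_mul_eq_one_left h.symm

theorem mul_self_units (ε : ℤˣ) : ε * ε = 1 := by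
  rw [← sq, Int.units_sq]

theorem apply_mem_halfTree_iff (hT : IsSemiregularTree T d type) (g : T ≃g T) (a b w : V) :
    g w ∈ halfTree T (g a) (g b) ↔ w ∈ halfTree T a b := by
  simp only [halfTree, mem_ofPred_eq, dist_apply hT]

theorem exists_line_through (hd : ∀ t, 4 ≤ d t) (hT : IsSemiregularTree T d type) (a b : V) :
    ∃ l, IsLine T l ∧ l 0 = a ∧ l (T.dist a b) = b := by
  obtain ⟨r, hr, hr0, hrb⟩ := exists_ray_through hT hd a b
  obtain ⟨z, hz, hzr, -⟩ := exists_neighbor hT hd a (r 1) (r 1) (r 1)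
  obtain ⟨s, hs, hs0, hs1⟩ := exists_ray hT hd hz
  obtain ⟨l, hl, h1, -⟩ := exists_line_of_rays hr hs (hr0.trans hs0.symm) (by
    rw [hs1]; exact hzr.symm)
  exact ⟨l, hl, (h1 0).trans hr0, (h1 _).trans hrb⟩

theorem exists_line_neighbors (hd : ∀ t, 4 ≤ d t) (hT : IsSemiregularTree T d type) {a b c : V}
    (hb : T.Adj a b) (hc : T.Adj a c) (hbc : b ≠ c) :
    ∃ l, IsLine T l ∧ l 0 = a ∧ l 1 = b ∧ l (-1) = c := by
  obtain ⟨r, hr, hr0, hr1⟩ := exists_ray hT hd hb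
  obtain ⟨s, hs, hs0, hs1⟩ := exists_ray hT hd hc
  obtain ⟨l, hl, h1, h2⟩ := exists_line_of_rays hr hs (hr0.trans hs0.symm) (by rwa [hs1, hr1])
  exact ⟨l, hl, (h1 0).trans hr0, (h1 1).trans hr1, (h2 1).trans hs1⟩

/-- Pairs of vertices at the same distance, and of the same types, are conjugate under an
automorphism with even local actions. -/
theorem exists_aut_pair (hd : ∀ t, 4 ≤ d t) (hT : IsSemiregularTree T d type)
    (hi : IsLegalColoring T d type i) {a b a' b' : V} (ha : type a' = type a)
    (h : T.dist a' b' = T.dist a b) :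
    ∃ g ∈ autPlus T type, g a = a' ∧ g b = b' ∧ ∀ w, sgn hi g w = 1 := by
  obtain ⟨l, hl, h1, h2⟩ := exists_line_through hd hT a b
  obtain ⟨l', hl', h1', h2'⟩ := exists_line_through hd hT a' b'
  obtain ⟨g, hg, hgl, hs⟩ := exists_aut_line hd hT hi hl hl' (by rw [h1, h1', ha])
  exact ⟨g, hg, by rw [← h1, hgl, h1'], by rw [← h2, hgl, ← h2', h], hs⟩

/-- A vertex adjacent to a line, but not on it. -/
theorem IsLine.dist_branch (hT : T.IsTree) {l : ℤ → V} (hl : IsLine T l) {j : ℤ} {y : V}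
    (h : T.Adj (l j) y) (h1 : y ≠ l (j + 1)) (h2 : y ≠ l (j - 1)) (k : ℤ) :
    T.dist (l k) y = T.dist (l k) (l j) + 1 := by
  have h3 := hl.1 (j - 1)
  rw [sub_add_cancel] at h3
  rcases lt_trichotomy k j with hk | rfl | hk
  · refine dist_of_ne_closer hT h3 h ?_ h2.symm
    rw [hl.dist hT, hl.dist hT]
    omega
  · rw [dist_eq_one h, T.dist_self]
  · refine dist_of_ne_closer hT (hl.1 j).symm h ?_ h1.symm
    rw [hl.dist hT, hl.dist hT]
    omega

/-- Pointwise convergent sequences of automorphisms converge to automorphisms. -/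
theorem exists_limit (hd : ∀ t, 4 ≤ d t) (hT : IsSemiregularTree T d type) (v : ℕ → T ≃g T)
    (h : ∀ w, ∃ y, ∀ᶠ k in atTop, v k w = y) :
    ∃ g : T ≃g T, ∀ s : Set V, s.Finite → ∀ᶠ k in atTop, ∀ w ∈ s, v k w = g w := by
  choose f hf using h
  have key : ∀ s : Set V, s.Finite → ∀ᶠ k in atTop, ∀ w ∈ s, v k w = f w := fun s hs =>
    (eventually_all_finite hs).2 fun w _ => hf w
  obtain ⟨g, hg⟩ := exists_aut_of_bijOn hT.isTree f fun w => by
    obtain ⟨k, hk⟩ := (key _ ((neighborSet_finite hT hd w).insert w)).exists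
    rw [← hk w (mem_insert _ _)]
    have hb : BijOn (v k) (T.neighborSet w) (T.neighborSet (v k w)) :=
      ⟨fun x hx => (v k).map_adj_iff.2 hx, (v k).injective.injOn, fun y hy =>
        ⟨(v k).symm y, ((v k).map_adj_iff).1 (by rw [(v k).apply_symm_apply]; exact hy),
          (v k).apply_symm_apply y⟩⟩
    exact hb.congr fun x hx => hk x (mem_insert_of_mem _ hx)
  exact ⟨g, by rw [hg]; exact key⟩

/-- An automorphism fixing an edge can be restricted to one of the two half-trees. -/
theorem exists_restrict (hT : IsSemiregularTree T d type) (hi : IsLegalColoring T d type i)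
    {g : T ≃g T} (hg : g ∈ autPlus T type) {a b : V} (hab : T.Adj a b) (ha : g a = a)
    (hb : g b = b) :
    ∃ g₁ ∈ autPlus T type, (∀ w ∈ halfTree T a b, g₁ w = g w) ∧ (∀ w ∉ halfTree T a b, g₁ w = w) ∧
      (∀ w ∈ halfTree T a b, sgn hi g₁ w = sgn hi g w) ∧
      ∀ w ∉ halfTree T a b, sgn hi g₁ w = 1 := by
  classical
  let f : V → V := fun w => if w ∈ halfTree T a b then g w else w
  have hf1 : ∀ w ∈ halfTree T a b, f w = g w := fun w hw => if_pos hw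
  have hf2 : ∀ w ∉ halfTree T a b, f w = w := fun w hw => if_neg hw
  -- As `g` fixes `a` and `b`, the two rules agree across the edge, so `f` coincides near each
  -- vertex with `g` or with the identity.
  have hn1 : ∀ w ∈ halfTree T a b, ∀ x, T.Adj w x → f x = g x := fun w hw x hx => by
    by_cases hxA : x ∈ halfTree T a b
    · exact hf1 x hxA
    · obtain ⟨rfl, -⟩ := eq_of_adj_halfTree hT.isTree hab hx.symm
        ((notMem_halfTree hT.isTree hab).1 hxA) hw
      rw [hf2 x hxA, ha]
  have hn2 : ∀ w ∉ halfTree T a b, ∀ x, T.Adj w x → f x = x := fun w hw x hx => by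
    by_cases hxA : x ∈ halfTree T a b
    · obtain ⟨-, rfl⟩ := eq_of_adj_halfTree hT.isTree hab hx
        ((notMem_halfTree hT.isTree hab).1 hw) hxA
      rw [hf1 x hxA, hb]
    · exact hf2 x hxA
  obtain ⟨g₁, hg₁⟩ := exists_aut_of_bijOn hT.isTree f fun w => by
    by_cases hw : w ∈ halfTree T a b
    · rw [hf1 w hw]
      have hb : BijOn g (T.neighborSet w) (T.neighborSet (g w)) :=
        ⟨fun x hx => g.map_adj_iff.2 hx, g.injective.injOn, fun y hy =>
          ⟨g.symm y, (g.map_adj_iff).1 (by rw [g.apply_symm_apply]; exact hy),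
            g.apply_symm_apply y⟩⟩
      exact hb.congr fun x hx => (hn1 w hw x hx).symm
    · rw [hf2 w hw]
      exact (bijOn_id _).congr fun x hx => (hn2 w hw x hx).symm
  rw [← hg₁] at hf1 hf2 hn1 hn2
  refine ⟨g₁, fun w => ?_, hf1, hf2, fun w hw => sgn_congr hi fun x hx => hn1 w hw x hx,
    fun w hw => ?_⟩
  · by_cases hw : w ∈ halfTree T a b
    · rw [hf1 w hw, hg w]
    · rw [hf2 w hw]
  · rw [← sgn_one hi w]
    exact sgn_congr hi fun x hx => hn2 w hw x hx

end Lemmas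

/-! ### Simplicity. -/

section Simplicity

variable {V : Type*} {T : SimpleGraph V} {d : Fin 2 → ℕ} {type : V → Fin 2} {i : V → ℕ}

/-- If `m ∈ N` moves a set `A` to pairwise disjoint translates, then elements `u` supported on `A`
are commutators of `m` with the infinite product of the conjugates of `u` by powers of `m`. -/
theorem mem_of_supported (hd : ∀ t, 4 ≤ d t) (hT : IsSemiregularTree T d type)
    (hi : IsLegalColoring T d type i) (Y : Fin 2 → Finset ℕ) {N : Subgroup (T ≃g T)}
    (hN : N ≤ GPlus hT hi Y) (hnorm : ∀ h ∈ GPlus hT hi Y, ∀ n ∈ N, h * n * h⁻¹ ∈ N)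
    {m : T ≃g T} (hm : m ∈ N) {A C : Set V} (hC : ∀ w ∈ C, m w ∈ C) (hA : A ⊆ C)
    (hAm : ∀ w ∈ C, m w ∉ A) {u : T ≃g T} (hu : u ∈ GPlus hT hi Y) (huA : ∀ w ∉ A, u w = w) :
    u ∈ N := by
  -- `v k` is the product of the conjugates of `u` by `m ^ j` for `j < k`.
  let v : ℕ → T ≃g T := fun k =>
    Nat.rec 1 (fun k x => x * (m ^ k * u * (m ^ k)⁻¹)) k
  have hv0 : v 0 = 1 := rfl
  have hvs : ∀ k, v (k + 1) = v k * (m ^ k * u * (m ^ k)⁻¹) := fun k => rfl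
  have hvs' : ∀ k, v (k + 1) = u * (m * v k * m⁻¹) := by
    intro k
    induction k with
    | zero => rw [hvs, hv0]; group
    | succ k ih =>
      rw [hvs (k + 1)]
      nth_rw 1 [ih]
      rw [hvs k, pow_succ']
      group
  have hvH : ∀ k, v k ∈ GPlus hT hi Y := by
    intro k
    induction k with
    | zero => exact one_mem _
    | succ k ih =>
      have := pow_mem (hN hm) k
      exact mul_mem ih (mul_mem (mul_mem this hu) (inv_mem this))
  have hpow : ∀ k, ∀ w ∈ C, (m ^ k) w ∈ C := by
    intro k
    induction k with
    | zero => exact fun w hw => hw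
    | succ k ih =>
      intro w hw
      rw [pow_succ']
      exact hC _ (ih w hw)
  have hpowA : ∀ k, ∀ w ∈ A, (m ^ (k + 1)) w ∉ A := by
    intro k w hw
    rw [pow_succ']
    exact hAm _ (hpow k w (hA hw))
  -- The translates of `A` by powers of `m` are disjoint, so all but at most one factor fix `w`, and
  -- the product stabilizes there.
  have hev : ∀ w, ∃ j, ∀ k, j ≤ k → ((m ^ k)⁻¹ : T ≃g T) w ∉ A := by
    intro w
    by_cases h : ∃ j, ((m ^ j)⁻¹ : T ≃g T) w ∈ A
    · obtain ⟨j, hj⟩ := h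
      refine ⟨j + 1, fun k hk hkA => ?_⟩
      refine hpowA (k - j - 1) _ hkA ?_
      have : m ^ (k - j - 1 + 1) * (m ^ k)⁻¹ = (m ^ j)⁻¹ := by
        rw [show k = (k - j - 1 + 1) + j by omega, pow_add _ _ j,
          show k - j - 1 + 1 + j - j - 1 + 1 = k - j - 1 + 1 by omega]
        rw [← pow_add, add_comm, pow_add]
        group
      rw [← RelIso.mul_apply, this]
      exact hj
    · push Not at h
      exact ⟨0, fun k _ => h k⟩
  obtain ⟨g, hg⟩ := exists_limit hd hT v fun w => by
    obtain ⟨j, hj⟩ := hev w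
    refine ⟨v j w, eventually_atTop.2 ⟨j, fun k hk => ?_⟩⟩
    induction k, hk using Nat.le_induction with
    | base => rfl
    | succ k hk ih =>
      rw [hvs, RelIso.mul_apply, RelIso.mul_apply, RelIso.mul_apply, huA _ (hj k hk),
        RelIso.apply_inv_self, ih]
  have hgH : g ∈ GPlus hT hi Y := mem_GPlus_of_forall_finite hT hi Y fun s hs => by
    obtain ⟨k, hk⟩ := (hg s hs).exists
    exact ⟨v k, hvH k, hk⟩
  -- This is the limit of `hvs'`; it exhibits `u` as the commutator of `g` and `m`.
  have hgu : g = u * (m * g * m⁻¹) := by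
    ext w
    obtain ⟨k, hk1, hk2⟩ := (((tendsto_add_atTop_nat 1).eventually (hg {w} (finite_singleton w))).and
      (hg {m⁻¹ w} (finite_singleton _))).exists
    rw [← hk1 w rfl, hvs']
    simp only [RelIso.mul_apply]
    rw [hk2 _ rfl]
  have : u = (g * m * g⁻¹) * m⁻¹ := by
    have h1 : u = g * (m * g * m⁻¹)⁻¹ := eq_mul_inv_of_mul_eq hgu.symm
    rw [h1]
    group
  rw [this]
  exact mul_mem (hnorm g hgH m hm) (inv_mem hm)

/-- A nontrivial normal subgroup contains an element shifting a half-tree into itself. -/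
theorem exists_shift (hd : ∀ t, 4 ≤ d t) (hT : IsSemiregularTree T d type)
    (hi : IsLegalColoring T d type i) (Y : Fin 2 → Finset ℕ) {N : Subgroup (T ≃g T)}
    (hN : N ≤ GPlus hT hi Y) (hnorm : ∀ h ∈ GPlus hT hi Y, ∀ n ∈ N, h * n * h⁻¹ ∈ N)
    {n : T ≃g T} (hn : n ∈ N) (hn1 : n ≠ 1) :
    ∃ m ∈ N, ∃ l, IsLine T l ∧
      ∀ w ∈ halfTree T (l 1) (l 0), m w ∈ halfTree T (l (-1)) (l (-2)) := by
  have hTT := hT.isTree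
  obtain ⟨x, hx⟩ : ∃ x, n x ≠ x := by
    by_contra! h
    exact hn1 (RelIso.ext h)
  have hD0 : T.dist x (n x) ≠ 0 := fun h => hx (eq_of_dist_zero hTT h).symm
  have hD : Even (T.dist x (n x)) := (type_eq_iff_even hT _ _).1 ((hN hn).1 x).symm
  set D := T.dist x (n x) with hDdef
  obtain ⟨a, ha, hda⟩ := exists_closer hTT (p := n x) (w := x) (by rwa [dist_symm])
  obtain ⟨b, hb, hdb⟩ := exists_closer hTT (p := x) (w := n x) hD0
  -- Avoiding `a` and `n⁻¹ b` makes `y, x, …, n x, n y` a geodesic of length `D + 2`, and `n`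
  -- carries the half-tree beyond `y` to the one beyond `n y`.
  obtain ⟨y, hy, hya, hyb, -⟩ := exists_neighbor hT hd x a (n⁻¹ b) a
  have hny : T.Adj (n x) (n y) := n.map_adj_iff.2 hy
  have hnyb : b ≠ n y := fun h => hyb (by rw [h, RelIso.inv_apply_self])
  have h1 : T.dist y (n x) = D + 1 := by
    rw [dist_symm T y, dist_of_ne_closer hTT ha hy hda hya.symm, dist_symm T _ x]
  have h2 : T.dist y b = D := by
    have h3 := dist_tri hTT y x b
    have h4 := dist_eq_one hy.symm
    rcases dist_adj hTT y hb with h | h <;> omega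
  have h3 : T.dist y (n y) = D + 2 := by
    rw [dist_of_ne_closer hTT hb hny (by omega) hnyb, h1]
  have h4 : T.dist x (n y) = D + 1 := dist_of_ne_closer hTT hb hny hdb hnyb
  obtain ⟨l, hl, hl0, hlD⟩ := exists_line_through hd hT y (n y)
  rw [h3] at hlD
  push_cast at hlD
  have hld : ∀ j k, T.dist (l j) (l k) = (k - j).natAbs := hl.dist hTT
  have hl1 : l 1 = x := by
    refine between_unique hTT (p := y) (w := n y) ?_ ?_ ?_
    · rw [← hlD, ← hl0, hld, hld, hld]; omega
    · rw [h3, dist_eq_one hy.symm, h4]; omega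
    · rw [← hl0, hld, hl0, dist_eq_one hy.symm]; rfl
  have hlD1 : l (D + 1) = n x := by
    refine between_unique hTT (p := y) (w := n y) ?_ ?_ ?_
    · rw [← hlD, ← hl0, hld, hld, hld]; omega
    · rw [h3, h1, dist_eq_one hny]
    · rw [← hl0, hld, hl0, h1]; omega
  have hl' : IsLine T fun k => l (k - 2) := ⟨fun k => by
    have := hl.1 (k - 2)
    rwa [show k - 2 + 1 = k + 1 - 2 by ring] at this, fun k => by
    have := hl.2 (k - 2)
    rwa [show k - 2 + 2 = k + 2 - 2 by ring] at this⟩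
  obtain ⟨h, hh, hhl, hhs⟩ := exists_aut_line hd hT hi hl hl' ((type_eq_iff_even hT _ _).2 (by
    rw [hld]; decide))
  have hhH := mem_GPlus_of_sgn hT hi Y hh hhs
  -- Since `h` shifts the line by -2, the half-tree beyond `n y` lies in its own `h`-image, which `h
  -- * n⁻¹ * h⁻¹` carries to the half-tree beyond `l (-2)`.
  refine ⟨(h * n⁻¹ * h⁻¹) * n, mul_mem (hnorm h hhH _ (inv_mem hn)) hn, l, hl, fun w hw => ?_⟩
  rw [hl1, hl0] at hw
  have e1 : n w ∈ halfTree T (n x) (n y) := (apply_mem_halfTree_iff hT n _ _ _).2 hw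
  have e2 : n w ∈ halfTree T (h (n x)) (h (n y)) := by
    rw [← hlD1, ← hlD, hhl, hhl]
    rw [← hlD1, ← hlD] at e1
    refine halfTree_subset hTT (r := l (D + 1)) (s := l (D + 2)) ?_ ?_ ?_ ?_ e1
    · have := hl.1 (D + 1)
      rwa [show (D : ℤ) + 1 + 1 = D + 2 by ring] at this
    all_goals
      rw [hld, hld]
      omega
  have e3 : h⁻¹ (n w) ∈ halfTree T (n x) (n y) := by
    rw [← apply_mem_halfTree_iff hT h, RelIso.apply_inv_self]
    exact e2
  have e4 : n⁻¹ (h⁻¹ (n w)) ∈ halfTree T (l 1) (l 0) := by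
    rw [← apply_mem_halfTree_iff hT n, RelIso.apply_inv_self, hl1, hl0]
    exact e3
  have e5 := (apply_mem_halfTree_iff hT h _ _ _).2 e4
  rw [hhl, hhl] at e5
  exact e5

/-- A nontrivial normal subgroup contains the elements supported on a half-tree. -/
theorem mem_of_supported_halfTree (hd : ∀ t, 4 ≤ d t) (hT : IsSemiregularTree T d type)
    (hi : IsLegalColoring T d type i) (Y : Fin 2 → Finset ℕ) {N : Subgroup (T ≃g T)}
    (hN : N ≤ GPlus hT hi Y) (hnorm : ∀ h ∈ GPlus hT hi Y, ∀ n ∈ N, h * n * h⁻¹ ∈ N)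
    (hne : ∃ n ∈ N, n ≠ 1) {a b : V} (hab : T.Adj a b) {u : T ≃g T} (hu : u ∈ GPlus hT hi Y)
    (huA : ∀ w ∉ halfTree T a b, u w = w) : u ∈ N := by
  have hTT := hT.isTree
  obtain ⟨n, hn, hn1⟩ := hne
  obtain ⟨m, hm, l, hl, hml⟩ := exists_shift hd hT hi Y hN hnorm hn hn1
  have hld : ∀ j k, T.dist (l j) (l k) = (k - j).natAbs := hl.dist hTT
  -- A half-tree branching off at `l 0` or `l (-1)`, whichever has the type of `a`, lies in the
  -- shifted half-tree but misses its image under `m`.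
  obtain ⟨j, hj, hjt⟩ : ∃ j : ℤ, (j = 0 ∨ j = -1) ∧ type (l j) = type a := by
    have := hT.type_ne (hl.1 (-1))
    rw [show (-1 : ℤ) + 1 = 0 by rfl] at this
    by_cases h : type (l 0) = type a
    · exact ⟨0, Or.inl rfl, h⟩
    · exact ⟨-1, Or.inr rfl, by omega⟩
  obtain ⟨y, hy, hy1, hy2, -⟩ := exists_neighbor hT hd (l j) (l (j + 1)) (l (j - 1)) (l j)
  have hbr := hl.dist_branch hTT hy hy1 hy2
  obtain ⟨g, hg, hga, hgb, hgs⟩ := exists_aut_pair hd hT hi (a := a) (b := b) (a' := l j) (b' := y)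
    hjt (by rw [dist_eq_one hy, dist_eq_one hab])
  have hgH := mem_GPlus_of_sgn hT hi Y hg hgs
  have hl21 : T.Adj (l (-1)) (l (-2)) := by
    have := hl.1 (-2)
    rw [show (-2 : ℤ) + 1 = -1 by norm_num] at this
    exact this.symm
  have key : g * u * g⁻¹ ∈ N := by
    refine mem_of_supported hd hT hi Y hN hnorm hm (A := halfTree T (l j) y)
      (C := halfTree T (l 1) (l 0)) (fun w hw => ?_) ?_ (fun w hw hw' => ?_)
      (mul_mem (mul_mem hgH hu) (inv_mem hgH)) fun w hw => ?_
    · refine halfTree_subset hTT (r := l (-1)) (s := l (-2)) hl21 ?_ ?_ ?_ (hml w hw)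
      all_goals
        rw [hld, hld]
        omega
    · refine halfTree_subset hTT hy ?_ ?_ ?_
      · rw [hbr]; omega
      · rw [hbr]; omega
      · rw [hld, hld]; omega
    · have h1 := dist_across hTT hy hw' (v := l (-1)) (by rw [hbr]; omega)
      have h2 := dist_across hTT hy hw' (v := l (-2)) (by rw [hbr]; omega)
      have h3 : T.dist (m w) (l (-2)) < T.dist (m w) (l (-1)) := hml w hw
      rw [hld] at h1 h2
      omega
    · have : g⁻¹ w ∉ halfTree T a b := by
        rw [← apply_mem_halfTree_iff hT g, RelIso.apply_inv_self, hga, hgb]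
        exact hw
      rw [RelIso.mul_apply, RelIso.mul_apply, huA _ this, RelIso.apply_inv_self]
  have := hnorm g⁻¹ (inv_mem hgH) _ key
  rwa [show g⁻¹ * (g * u * g⁻¹) * g⁻¹⁻¹ = u by group] at this

/-- Elements fixing an edge, and whose restriction to one of the half-trees is in the group. -/
theorem mem_of_restrict_mem (hd : ∀ t, 4 ≤ d t) (hT : IsSemiregularTree T d type)
    (hi : IsLegalColoring T d type i) (Y : Fin 2 → Finset ℕ) {N : Subgroup (T ≃g T)}
    (hN : N ≤ GPlus hT hi Y) (hnorm : ∀ h ∈ GPlus hT hi Y, ∀ n ∈ N, h * n * h⁻¹ ∈ N)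
    (hne : ∃ n ∈ N, n ≠ 1) {a b : V} (hab : T.Adj a b) {g g₁ : T ≃g T} (hg : g ∈ GPlus hT hi Y)
    (hg₁ : g₁ ∈ GPlus hT hi Y) (h1 : ∀ w ∈ halfTree T a b, g₁ w = g w)
    (h2 : ∀ w ∉ halfTree T a b, g₁ w = w) : g ∈ N := by
  have e1 : g₁ ∈ N := mem_of_supported_halfTree hd hT hi Y hN hnorm hne hab hg₁ h2
  have e2 : g₁⁻¹ * g ∈ N := mem_of_supported_halfTree hd hT hi Y hN hnorm hne hab.symm
    (mul_mem (inv_mem hg₁) hg) fun w hw => by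
      rw [notMem_halfTree hT.isTree hab.symm] at hw
      rw [RelIso.mul_apply, ← h1 w hw, RelIso.inv_apply_self]
  have := mul_mem e1 e2
  rwa [mul_inv_cancel_left] at this

/-- Truncation to a half-tree keeps all signatures 1, which settles elements fixing an edge.
Correcting by even elements reduces the general case to a fixed vertex, and that to a fixed edge. -/
theorem mem_of_even (hd : ∀ t, 4 ≤ d t) (hT : IsSemiregularTree T d type)
    (hi : IsLegalColoring T d type i) (Y : Fin 2 → Finset ℕ) {N : Subgroup (T ≃g T)}
    (hN : N ≤ GPlus hT hi Y) (hnorm : ∀ h ∈ GPlus hT hi Y, ∀ n ∈ N, h * n * h⁻¹ ∈ N)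
    (hne : ∃ n ∈ N, n ≠ 1) {u : T ≃g T} (hu : u ∈ autPlus T type) (hs : ∀ w, sgn hi u w = 1) :
    u ∈ N := by
  have hTT := hT.isTree
  have hmul : ∀ {g h : T ≃g T}, (∀ w, sgn hi g w = 1) → (∀ w, sgn hi h w = 1) →
      ∀ w, sgn hi (g⁻¹ * h) w = 1 := fun {g h} hg hh w => by
    have := sgn_inv_apply hi g (g⁻¹ (h w))
    rw [RelIso.apply_inv_self] at this
    rw [sgn_mul, hh, this, hg, one_mul]
  have edge : ∀ u ∈ autPlus T type, (∀ w, sgn hi u w = 1) → ∀ a b, T.Adj a b → u a = a →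
      u b = b → u ∈ N := by
    intro u hu hs a b hab ha hb
    obtain ⟨g₁, h1, h2, h3, h4, h5⟩ := exists_restrict hT hi hu hab ha hb
    refine mem_of_restrict_mem hd hT hi Y hN hnorm hne hab (mem_GPlus_of_sgn hT hi Y hu hs)
      (mem_GPlus_of_sgn hT hi Y h1 fun w => ?_) h2 h3
    by_cases hw : w ∈ halfTree T a b
    · rw [h4 w hw, hs]
    · exact h5 w hw
  have vertex : ∀ u ∈ autPlus T type, (∀ w, sgn hi u w = 1) → ∀ a, u a = a → u ∈ N := by
    intro u hu hs a ha
    obtain ⟨b, hb, -⟩ := exists_neighbor hT hd a a a a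
    -- With `c` off `b` and `u b`, some even `g` fixes `a` and `c` and agrees with `u` at `b`.
    obtain ⟨c, hc, hcb, hcu, -⟩ := exists_neighbor hT hd a b (u b) a
    have hub : T.Adj a (u b) := by
      have := u.map_adj_iff.2 hb
      rwa [ha] at this
    obtain ⟨l, hl, hl0, hl1, hlm⟩ := exists_line_neighbors hd hT hb hc hcb.symm
    obtain ⟨l', hl', hl0', hl1', hlm'⟩ := exists_line_neighbors hd hT hub hc hcu.symm
    obtain ⟨g, hg, hgl, hgs⟩ := exists_aut_line hd hT hi hl hl' (by rw [hl0, hl0'])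
    have ga : g a = a := by
      have := hgl 0
      rwa [hl0, hl0'] at this
    have gb : g b = u b := by
      have := hgl 1
      rwa [hl1, hl1'] at this
    have gc : g c = c := by
      have := hgl (-1)
      rwa [hlm, hlm'] at this
    have e1 := edge g hg hgs a c hc ga gc
    have e2 := edge (g⁻¹ * u) (mul_mem (inv_mem hg) hu) (hmul hgs hs) a b hb
      (by rw [RelIso.mul_apply, ha]; nth_rw 1 [← ga]; exact RelIso.inv_apply_self g a)
      (by rw [RelIso.mul_apply, ← gb, RelIso.inv_apply_self])
    have := mul_mem e1 e2
    rwa [mul_inv_cancel_left] at this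
  obtain ⟨x⟩ := hTT.connected.nonempty
  obtain ⟨k, hk⟩ := (type_eq_iff_even hT _ _).1 (hu x).symm
  -- `z` is the midpoint of `x` and `u x`, about which an even element can rotate `x` to `u x`.
  obtain ⟨z, hz1, hz2⟩ := exists_between hTT hk
  obtain ⟨g, hg, hgz, hgx, hgs⟩ := exists_aut_pair hd hT hi (a := z) (b := x) (a' := z)
    (b' := u x) rfl (by rw [hz2, dist_symm, hz1])
  have e1 := vertex g hg hgs z hgz
  have e2 := vertex (g⁻¹ * u) (mul_mem (inv_mem hg) hu) (hmul hgs hs) x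
    (by rw [RelIso.mul_apply, ← hgx, RelIso.inv_apply_self])
  have := mul_mem e1 e2
  rwa [mul_inv_cancel_left] at this

/-- A sphere centred on one side of the edge meets the other side only within distance `n` of `x`,
where `g` has signature 1. So truncating `g` preserves all the conditions. -/
theorem mem_of_fix_ball (hd : ∀ t, 4 ≤ d t) (hT : IsSemiregularTree T d type)
    (hi : IsLegalColoring T d type i) (Y : Fin 2 → Finset ℕ) {N : Subgroup (T ≃g T)}
    (hN : N ≤ GPlus hT hi Y) (hnorm : ∀ h ∈ GPlus hT hi Y, ∀ n ∈ N, h * n * h⁻¹ ∈ N)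
    (hne : ∃ n ∈ N, n ≠ 1) {g : T ≃g T} (hg : g ∈ GPlus hT hi Y) (x : V) {n : ℕ}
    (hn : ∀ t, maxRadius (Y t) ≤ n) (hfix : ∀ w, T.dist x w ≤ n + 1 → g w = w) : g ∈ N := by
  obtain ⟨b, hb, -⟩ := exists_neighbor hT hd x x x x
  have hTT := hT.isTree
  obtain ⟨g₁, h1, h2, h3, h4, h5⟩ := exists_restrict hT hi hg.1 hb (hfix x (by simp))
    (hfix b (by rw [dist_eq_one hb]; omega))
  have hs : ∀ w, T.dist x w ≤ n → sgn hi g w = 1 := fun w hw => by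
    rw [← sgn_one hi w]
    refine sgn_congr hi fun y hy => hfix y ?_
    rcases dist_adj hTT x hy with h | h <;> omega
  refine mem_of_restrict_mem hd hT hi Y hN hnorm hne hb hg ⟨h1, fun t v hv => ?_⟩ h2 h3
  by_cases hvA : v ∈ halfTree T x b
  · rw [← hg.2 t v hv]
    refine finprod_mem_congr rfl fun w hw => ?_
    by_cases hwA : w ∈ halfTree T x b
    · exact h4 w hwA
    · have e1 := dist_across hTT hb hvA ((notMem_halfTree hTT hb).1 hwA)
      have e2 : T.dist v w ≤ maxRadius (Y t) := le_maxRadius hw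
      have := hn t
      rw [h5 w hwA, hs w (by omega)]
  · refine finprod_mem_of_eqOn_one fun w hw => ?_
    by_cases hwA : w ∈ halfTree T x b
    · have e1 := dist_across hTT hb hwA ((notMem_halfTree hTT hb).1 hvA)
      have e2 : T.dist v w ≤ maxRadius (Y t) := le_maxRadius hw
      have e3 := dist_tri hTT x v w
      have := hn t
      have e4 : T.dist x w ≤ n := by
        have := dist_tri hTT x b w
        have := dist_eq_one hb
        have := dist_symm T b w
        have := dist_symm T v w
        omega
      rw [h4 w hwA, hs w e4]
      rfl
    · exact h5 w hwA

/-- The factorization is `g = u₂ * e * u₁`. Here `u₁` fixes a ball about a remote vertex `p` and has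
the signatures of `g` near `x`, `u₂` is even and agrees with `g * u₁⁻¹` near `u₁ x`, and `e` fixes a
ball about `u₁ x`. -/
theorem GPlus_le_of_normal (hd : ∀ t, 4 ≤ d t) (hT : IsSemiregularTree T d type)
    (hi : IsLegalColoring T d type i) (Y : Fin 2 → Finset ℕ) {N : Subgroup (T ≃g T)}
    (hN : N ≤ GPlus hT hi Y) (hnorm : ∀ h ∈ GPlus hT hi Y, ∀ n ∈ N, h * n * h⁻¹ ∈ N)
    (hne : ∃ n ∈ N, n ≠ 1) : GPlus hT hi Y ≤ N := by
  classical
  intro g hg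
  have hTT := hT.isTree
  obtain ⟨x⟩ := hTT.connected.nonempty
  obtain ⟨n, hn⟩ : ∃ n, ∀ t, maxRadius (Y t) ≤ n :=
    ⟨Finset.univ.sup fun t => maxRadius (Y t), fun t =>
      Finset.le_sup (f := fun t => maxRadius (Y t)) (Finset.mem_univ t)⟩
  -- This distance makes the balls of radius `n` about `x` and `p` disjoint, so signs on them can be
  -- prescribed independently.
  obtain ⟨p, hp, -⟩ := exists_away hT hd x x x (2 * n + 2)
  have hsph : ∀ t v w, w ∈ spheres T (Y t) v → T.dist v w ≤ maxRadius (Y t) :=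
    fun t v w hw => le_maxRadius hw
  obtain ⟨s, hsD, hs⟩ := exists_signs_spheres hT hi Y p {w | T.dist p w ≤ n ∨ T.dist x w ≤ n}
    (fun w => if T.dist x w ≤ n then sgn hi g w else 1) (fun _ _ => 1) (by
      intro t v _ hv
      by_cases h1 : T.dist p v + maxRadius (Y t) ≤ n
      · left
        have key : ∀ w ∈ spheres T (Y t) v, T.dist p w ≤ n := fun w hw => by
          have := dist_tri hTT p v w
          have := hsph t v w hw
          omega
        refine ⟨fun w hw => Or.inl (key w hw), finprod_mem_of_eqOn_one fun w hw => if_neg ?_⟩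
        have := dist_tri hTT x w p
        have := key w hw
        rw [dist_symm] at this
        omega
      by_cases h2 : T.dist x v + maxRadius (Y t) ≤ n
      · left
        have key : ∀ w ∈ spheres T (Y t) v, T.dist x w ≤ n := fun w hw => by
          have := dist_tri hTT x v w
          have := hsph t v w hw
          omega
        refine ⟨fun w hw => Or.inr (key w hw), ?_⟩
        rw [← hg.2 t v hv]
        exact finprod_mem_congr rfl fun w hw => if_pos (key w hw)
      · right
        -- Going away from both `x` and `p` leaves both balls, which yields a free pivot.
        obtain ⟨w, e1, e2, e3⟩ := exists_away hT hd v x p (maxRadius (Y t))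
        exact ⟨w, by simp only [mem_ofPred_eq, not_or]; omega, e1, e3⟩)
  obtain ⟨u₁, h1, h2, h3⟩ := exists_aut_extending_ball hd hT hi (one_mem (autPlus T type)) p (n + 1)
    s (fun w hw => by
      rw [hsD w (Or.inl (by omega)), sgn_one]
      refine if_neg ?_
      have := dist_tri hTT x w p
      have := dist_symm T p w
      omega)
  have hu₁ : u₁ ∈ GPlus hT hi Y := (mem_GPlus_iff hT hi Y _).2 ⟨h1, fun t v hY hv => by
    simp only [sgnProd, h3]
    exact hs t v hY hv⟩
  have hu₁N : u₁ ∈ N := mem_of_fix_ball hd hT hi Y hN hnorm hne hu₁ p hn h2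
  have hgu : g * u₁⁻¹ ∈ GPlus hT hi Y := mul_mem hg (inv_mem hu₁)
  obtain ⟨u₂, k1, k2, k3⟩ := exists_aut_extending_ball hd hT hi hgu.1 (u₁ x) (n + 1)
    (fun _ => 1) (fun w hw => by
      obtain ⟨v, rfl⟩ := u₁.surjective w
      rw [dist_apply hT] at hw
      rw [sgn_mul, RelIso.inv_apply_self, sgn_inv_apply, h3, hsD v (Or.inr (by omega)),
        if_pos (by omega), mul_self_units])
  have hu₂N := mem_of_even hd hT hi Y hN hnorm hne k1 k3
  have e := mem_of_fix_ball hd hT hi Y hN hnorm hne (mul_mem (inv_mem (hN hu₂N)) hgu) (u₁ x) hn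
    fun w hw => by
      rw [RelIso.mul_apply, ← k2 w hw, RelIso.inv_apply_self]
  have := mul_mem (mul_mem hu₂N e) hu₁N
  rwa [mul_inv_cancel_left, inv_mul_cancel_right] at this

theorem isSimpleGroup_GPlus (hd : ∀ t, 4 ≤ d t) (hT : IsSemiregularTree T d type)
    (hi : IsLegalColoring T d type i) (Y : Fin 2 → Finset ℕ) :
    IsSimpleGroup (GPlus hT hi Y) := by
  have hnt : Nontrivial (GPlus hT hi Y) := by
    obtain ⟨x⟩ := hT.isTree.connected.nonempty
    obtain ⟨b, hb, -⟩ := exists_neighbor hT hd x x x x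
    obtain ⟨c, hc, hcb, -⟩ := exists_neighbor hT hd x b b b
    obtain ⟨g, hg, -, hgb, hgs⟩ := exists_aut_pair hd hT hi (a := x) (b := b) (a' := x) (b' := c)
      rfl (by rw [dist_eq_one hb, dist_eq_one hc])
    refine ⟨⟨⟨g, mem_GPlus_of_sgn hT hi Y hg hgs⟩, 1, fun h => hcb ?_⟩⟩
    rw [← hgb, show g = 1 from congrArg Subtype.val h]
    rfl
  refine ⟨fun N hN => ?_⟩
  by_cases h : N = ⊥
  · exact Or.inl h
  · right
    obtain ⟨n, hn, hn1⟩ := (Subgroup.bot_or_exists_ne_one N).resolve_left h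
    have := GPlus_le_of_normal hd hT hi Y (N := N.map (GPlus hT hi Y).subtype)
      (Subgroup.map_subtype_le N) (by
        rintro h hh _ ⟨k, hk, rfl⟩
        exact ⟨⟨h, hh⟩ * k * ⟨h, hh⟩⁻¹, hN.conj_mem k hk _, rfl⟩)
      ⟨_, ⟨_, hn, rfl⟩, fun h => hn1 (Subtype.ext h)⟩
    rw [eq_top_iff]
    intro g _
    obtain ⟨k, hk, he⟩ := this g.2
    rwa [← Subtype.ext he]

end Simplicity

end SemiTree

namespace SemiTree

open Set

/-! ### The normalizer among type-preserving automorphisms. -/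

section Normalizer

/-- A map that is multiplicative on the normalizer of `H`, with kernel `H`, computes the quotient. -/
theorem nonempty_normalizerQuotient_mulEquiv {G M : Type*} [Group G] [Group M] (H : Subgroup G)
    (F : G → M)
    (hmul : ∀ g ∈ Subgroup.normalizer (H : Set G), ∀ h ∈ Subgroup.normalizer (H : Set G),
      F (g * h) = F g * F h)
    (hker : ∀ g ∈ Subgroup.normalizer (H : Set G), F g = 1 ↔ g ∈ H)
    (hsurj : ∀ m, ∃ g ∈ Subgroup.normalizer (H : Set G), F g = m) :
    Nonempty (NormalizerQuotient H ≃* M) := by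
  let φ : Subgroup.normalizer (H : Set G) →* M :=
    MonoidHom.mk' (fun g => F g) fun g h => hmul g g.2 h h.2
  have hφ : H.subgroupOf (Subgroup.normalizer (H : Set G)) = φ.ker := by
    ext g
    rw [Subgroup.mem_subgroupOf, MonoidHom.mem_ker]
    exact (hker g g.2).symm
  exact ⟨(QuotientGroup.quotientMulEquivOfEq hφ).trans
    (QuotientGroup.quotientKerEquivOfSurjective φ fun m => by
      obtain ⟨g, hg, rfl⟩ := hsurj m
      exact ⟨⟨g, hg⟩, rfl⟩)⟩

variable {V : Type*} {T : SimpleGraph V} {d : Fin 2 → ℕ} {type : V → Fin 2} {i : V → ℕ}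

/-- If the product of `h` at `v` is 1, the conjugate has product 1 at `g v` exactly when `g` has
equal products at `v` and `h v`. -/
theorem sgnProd_conj (hT : IsSemiregularTree T d type) (hi : IsLegalColoring T d type i)
    (g h : T ≃g T) (Y : Finset ℕ) (v : V) :
    sgnProd hi (g * h * g⁻¹) Y (g v) * sgnProd hi g Y v =
      sgnProd hi g Y (h v) * sgnProd hi h Y v := by
  rw [← sgnProd_mul hT, ← sgnProd_mul hT, inv_mul_cancel_right]

theorem exists_mem_GPlus_apply_eq (hd : ∀ t, 4 ≤ d t) (hT : IsSemiregularTree T d type)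
    (hi : IsLegalColoring T d type i) (Y : Fin 2 → Finset ℕ) {v v' : V} (h : type v' = type v) :
    ∃ g ∈ GPlus hT hi Y, g v = v' := by
  obtain ⟨g, hg, hgv, -, hs⟩ := exists_aut_pair hd hT hi (b := v) (b' := v') h (by simp)
  exact ⟨g, mem_GPlus_of_sgn hT hi Y hg hs, hgv⟩

theorem exists_aut_sgnProd (hd : ∀ t, 4 ≤ d t) (hT : IsSemiregularTree T d type)
    (hi : IsLegalColoring T d type i) (Y : Fin 2 → Finset ℕ) (ε : Fin 2 → ℤˣ) :
    ∃ g ∈ autPlus T type, ∀ t v, (Y t).Nonempty → Relevant type Y t v →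
      sgnProd hi g (Y t) v = ε t := by
  obtain ⟨p⟩ := hT.isTree.connected.nonempty
  obtain ⟨s, -, hs⟩ := exists_signs_spheres hT hi Y p ∅ (fun _ => 1) (fun t _ => ε t)
    fun t v _ _ => by
      obtain ⟨w, h1, -, h2⟩ := exists_away hT hd v p p (maxRadius (Y t))
      exact Or.inr ⟨w, id, h1, h2⟩
  obtain ⟨g, hg, -, hgs⟩ := exists_aut_extending_ball hd hT hi (one_mem (autPlus T type)) p 0 s
    fun w hw => (Nat.not_lt_zero _ hw).elim
  refine ⟨g, hg, fun t v hY hv => ?_⟩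
  simp only [sgnProd, hgs]
  exact hs t v hY hv

theorem exists_type (hd : ∀ t, 4 ≤ d t) (hT : IsSemiregularTree T d type) (t : Fin 2) :
    ∃ v, type v = t := by
  obtain ⟨p⟩ := hT.isTree.connected.nonempty
  obtain ⟨q, hq, -⟩ := exists_neighbor hT hd p p p p
  by_cases h : type p = t
  · exact ⟨p, h⟩
  · have := hT.type_ne hq
    exact ⟨q, by omega⟩

theorem exists_relevant (hd : ∀ t, 4 ≤ d t) (hT : IsSemiregularTree T d type)
    (Y : Fin 2 → Finset ℕ) (t : Fin 2) : ∃ v, Relevant type Y t v := by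
  obtain ⟨v, hv⟩ := exists_type hd hT ⟨((t : ℕ) + maxRadius (Y t)) % 2, by omega⟩
  exact ⟨v, by rw [Relevant, hv]⟩

/-- The units of `ℤ` form a cyclic group of order two. -/
theorem nonempty_units_mulEquiv : Nonempty (ℤˣ ≃* Multiplicative (ZMod 2)) :=
  ⟨mulEquivOfPrimeCardEq (p := 2) (by simp [Nat.card_eq_fintype_card])
    (by simp [Nat.card_eq_fintype_card])⟩

/-- `GPlus` is transitive on the vertices relevant for `t`, so by `sgnProd_conj` the products of a
normalizing element are constant there; `exists_aut_sgnProd` realizes all constants. -/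
theorem nonempty_normalizerQuotient_autPlus (hd : ∀ t, 4 ≤ d t) (hT : IsSemiregularTree T d type)
    (hi : IsLegalColoring T d type i) (Y : Fin 2 → Finset ℕ) :
    Nonempty (NormalizerQuotient ((GPlus hT hi Y).subgroupOf (autPlus T type)) ≃*
      (Fin (Finset.univ.filter fun t : Fin 2 => (Y t).Nonempty).card →
        Multiplicative (ZMod 2))) := by
  classical
  let K := {t : Fin 2 // (Y t).Nonempty}
  suffices Nonempty (NormalizerQuotient ((GPlus hT hi Y).subgroupOf (autPlus T type)) ≃*
      (K → ℤˣ)) by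
    obtain ⟨e⟩ := this
    obtain ⟨f⟩ := nonempty_units_mulEquiv
    have hK : Fintype.card K = (Finset.univ.filter fun t : Fin 2 => (Y t).Nonempty).card :=
      Fintype.card_subtype _
    exact ⟨e.trans (MulEquiv.arrowCongr (Fintype.equivFinOfCardEq hK) f)⟩
  choose x hx using exists_relevant hd hT Y
  have hconst : ∀ g ∈ Subgroup.normalizer
      ((GPlus hT hi Y).subgroupOf (autPlus T type) : Set (autPlus T type)),
      ∀ t v, Relevant type Y t v → sgnProd hi g.1 (Y t) v = sgnProd hi g.1 (Y t) (x t) := by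
    intro g hg t v hv
    obtain ⟨h, hh, rfl⟩ := exists_mem_GPlus_apply_eq hd hT hi Y (v := x t) (v' := v)
      (Fin.ext (hv.trans (hx t).symm))
    have h1 : (g : T ≃g T) * h * (g : T ≃g T)⁻¹ ∈ GPlus hT hi Y :=
      (Subgroup.mem_normalizer_iff.1 hg ⟨h, hh.1⟩).1 hh
    have h2 := sgnProd_conj hT hi g.1 h (Y t) (x t)
    rw [h1.2 t (g.1 (x t)) (by rw [g.2 (x t)]; exact hx t), hh.2 t (x t) (hx t), one_mul,
      mul_one] at h2
    exact h2.symm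
  refine nonempty_normalizerQuotient_mulEquiv _
    (fun g (t : K) => sgnProd hi (g : T ≃g T) (Y t) (x t)) ?_ ?_ ?_
  · intro g hg h hh
    funext t
    have h1 : Relevant type Y t (h.1 (x t)) := by
      rw [Relevant, h.2 (x t)]
      exact hx t
    simp only [Subgroup.coe_mul, Pi.mul_apply]
    rw [sgnProd_mul hT, hconst g hg t _ h1]
  · intro g hg
    rw [Subgroup.mem_subgroupOf, mem_GPlus_iff]
    refine ⟨fun h => ⟨g.2, fun t v hY hv => ?_⟩, fun h => ?_⟩
    · rw [hconst g hg t v hv]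
      exact congrFun h ⟨t, hY⟩
    · funext t
      exact h.2 t (x t) t.2 (hx t)
  · intro m
    obtain ⟨g, hg, hgs⟩ := exists_aut_sgnProd hd hT hi Y
      fun t => if h : (Y t).Nonempty then m ⟨t, h⟩ else 1
    refine ⟨⟨g, hg⟩, ?_, ?_⟩
    · rw [Subgroup.mem_normalizer_iff]
      intro h
      have key : ∀ t v, (Y t).Nonempty → Relevant type Y t v →
          sgnProd hi (g * h.1 * g⁻¹) (Y t) (g v) = sgnProd hi h.1 (Y t) v := by
        intro t v hY hv
        have h2 := sgnProd_conj hT hi g h.1 (Y t) v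
        have h3 : Relevant type Y t (h.1 v) := by
          rw [Relevant, h.2 v]
          exact hv
        rw [hgs t v hY hv, hgs t _ hY h3, mul_comm] at h2
        exact mul_left_cancel h2
      rw [Subgroup.mem_subgroupOf, Subgroup.mem_subgroupOf, mem_GPlus_iff, mem_GPlus_iff]
      refine ⟨fun h1 => ⟨Subtype.prop _, fun t v hY hv => ?_⟩,
        fun h1 => ⟨h.2, fun t v hY hv => ?_⟩⟩
      · have hv' : Relevant type Y t (g⁻¹ v) := by
          rw [Relevant, inv_mem hg v]
          exact hv
        have := key t (g⁻¹ v) hY hv'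
        rw [RelIso.apply_inv_self, h1.2 t _ hY hv'] at this
        exact this
      · rw [← key t v hY hv]
        exact h1.2 t (g v) hY (by rw [Relevant, hg v]; exact hv)
    · funext t
      show sgnProd hi g (Y t) (x t) = _
      rw [hgs t _ t.2 (hx t), dif_pos t.2]

end Normalizer

/-! ### The normalizer in the full automorphism group. -/

section Dihedral

variable {V : Type*} {T : SimpleGraph V} {d : Fin 2 → ℕ} {type : V → Fin 2} {i : V → ℕ}

/-- The coordinates (swap of types, signs at the two types) on the dihedral group of order `8`, seen
as a wreath product. -/
def dihedralOf (b : Bool) (a c : ℤˣ) : DihedralGroup 4 :=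
  if b then
    if a = 1 then if c = 1 then .sr 0 else .r 1
    else if c = 1 then .r 3 else .sr 2
  else
    if a = 1 then if c = 1 then .r 0 else .sr 1
    else if c = 1 then .sr 3 else .r 2

/-- This is `sgnProd_mul` in coordinates: if the right factor exchanges the types, the signs of the
left factor are read at the exchanged vertices. -/
theorem dihedralOf_mul : ∀ (b b' : Bool) (a c a' c' : ℤˣ),
    dihedralOf (b ^^ b') ((if b' then c else a) * a') ((if b' then a else c) * c') =
      dihedralOf b a c * dihedralOf b' a' c' := by
  decide

theorem dihedralOf_eq_one : ∀ (b : Bool) (a c : ℤˣ),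
    dihedralOf b a c = 1 ↔ b = false ∧ a = 1 ∧ c = 1 := by
  decide

theorem dihedralOf_surjective : ∀ z, ∃ (b : Bool) (a c : ℤˣ), dihedralOf b a c = z := by
  decide

theorem type_apply_eq_iff (hT : IsSemiregularTree T d type) (g : T ≃g T) (v w : V) :
    type (g v) = type (g w) ↔ type v = type w := by
  rw [type_eq_iff_even hT, type_eq_iff_even hT, dist_apply hT]

theorem conj_mem_autPlus_iff (hT : IsSemiregularTree T d type) (g h : T ≃g T) :
    g * h * g⁻¹ ∈ autPlus T type ↔ h ∈ autPlus T type := by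
  refine ⟨fun H v => ?_, fun H v => ?_⟩
  · have := H (g v)
    rw [RelIso.mul_apply, RelIso.mul_apply, RelIso.inv_apply_self] at this
    exact (type_apply_eq_iff hT g _ _).1 this
  · have := (type_apply_eq_iff hT g _ _).2 (H (g⁻¹ v))
    rwa [RelIso.apply_inv_self] at this

/-- An automorphism exchanging the two types and preserving the colors. -/
theorem exists_swap (hd : ∀ t, 4 ≤ d t) (hT : IsSemiregularTree T d type)
    (hi : IsLegalColoring T d type i) (hdd : d 0 = d 1) :
    ∃ g : T ≃g T, (∀ v, type (g v) ≠ type v) ∧ ∀ v, sgn hi g v = 1 := by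
  classical
  have hde : ∀ s t : Fin 2, d s = d t := by
    intro s t
    fin_cases s <;> fin_cases t <;> simp [hdd]
  have hbij : ∀ w w', BijOn i (T.neighborSet w') (Icc 1 (d (type w))) := fun w w' => by
    rw [hde (type w) (type w')]
    exact hi w'
  have hloc : ∀ w w', type w' ≠ type w →
      ∃ f, BijOn f (T.neighborSet w) (T.neighborSet w') ∧ (∀ x, T.Adj w x → i (f x) = i x) ∧
        ∀ x, T.Adj w x → i (f x) = i x ∧ type (f x) ≠ type x := by
    intro w w' hww'
    obtain ⟨y, hy, -⟩ := exists_neighbor hT hd w' w' w' w'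
    have hy' : Nonempty V := ⟨y⟩
    let f : V → V := fun x => Function.invFunOn i (T.neighborSet w') (i x)
    have hm : ∀ x, T.Adj w x → i x ∈ i '' T.neighborSet w' := fun x hx => by
      rw [(hbij w w').image_eq]
      exact (hi w).mapsTo hx
    have h1 : ∀ x, T.Adj w x → T.Adj w' (f x) := fun x hx => Function.invFunOn_mem (hm x hx)
    have h2 : ∀ x, T.Adj w x → i (f x) = i x := fun x hx => Function.invFunOn_eq (hm x hx)
    refine ⟨f, ⟨h1, fun x hx y hy hxy => ?_, fun y hy => ?_⟩, h2, fun x hx => ⟨h2 x hx, ?_⟩⟩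
    · have hxy : f x = f y := hxy
      exact (hi w).injOn hx hy (by rw [← h2 x hx, ← h2 y hy, hxy])
    · obtain ⟨x, hx, hxy⟩ := (hi w).surjOn ((hbij w w').mapsTo hy)
      exact ⟨x, hx, (hi w').injOn (h1 x hx) hy (by rw [h2 x hx, hxy])⟩
    · have e1 := hT.type_ne hx
      have e2 := hT.type_ne (h1 x hx)
      omega
  obtain ⟨p⟩ := hT.isTree.connected.nonempty
  obtain ⟨z, hz, -⟩ := exists_neighbor hT hd p p p p
  -- The root goes to its neighbour `q` of the same color as `p`, which has the other type.
  obtain ⟨q, hq, hqi⟩ := (hbij z p).surjOn ((hi z).mapsTo hz.symm)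
  obtain ⟨g, -, hg⟩ := exists_aut_of_local hT.isTree p q
    -- Equality of colors belongs to the invariant because it makes the color-preserving map around
    -- `w` send `u` to `u'`.
    (fun w w' => i w' = i w ∧ type w' ≠ type w) (fun w _ f => ∀ x, T.Adj w x → i (f x) = i x)
    ⟨⟨hqi, (hT.type_ne hq).symm⟩, hloc p q (hT.type_ne hq).symm⟩
    fun u w u' w' huw _ huw' hu hw => by
      obtain ⟨f, h1, h2, h3⟩ := hloc w w' hw.2
      exact ⟨f, h1, (hi w').injOn (h1.mapsTo huw.symm) huw'.symm
        ((h2 u huw.symm).trans hu.1.symm), h2, fun x hx _ => h3 x hx⟩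
  refine ⟨g, fun v => (hg v).1.2, fun v => ?_⟩
  obtain ⟨-, f, h1, h2⟩ := hg v
  refine LocalSign.sgn_eq hi (f := f) ⟨1, fun x hx c hc => ?_, Equiv.Perm.sign_one⟩ h2
  rw [h1 x hx, ← hc]
  rfl

/-- With `Y 0 = Y 1` the conditions cover all vertices alike, so they survive an exchange of types.
A normalizing element is then recorded by whether it exchanges types and by its constant product on
each type. -/
theorem nonempty_normalizerQuotient_aut (hd : ∀ t, 4 ≤ d t) (hT : IsSemiregularTree T d type)
    (hi : IsLegalColoring T d type i) (Y : Fin 2 → Finset ℕ) (hdd : d 0 = d 1) (hYY : Y 0 = Y 1)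
    (hY : (Y 0).Nonempty) :
    Nonempty (NormalizerQuotient (GPlus hT hi Y) ≃* DihedralGroup 4) := by
  classical
  have hYt : ∀ t, Y t = Y 0 := by
    intro t
    fin_cases t <;> simp [hYY]
  have hrel : ∀ v, ∃ t : Fin 2, ((t : ℕ) + maxRadius (Y 0)) % 2 = (type v : ℕ) ∧
      Relevant type Y t v := by
    intro v
    have h2 := (type v).2
    refine ⟨⟨((type v : ℕ) + maxRadius (Y 0)) % 2, by omega⟩, ?_⟩
    simp only [Relevant, hYt]
    omega
  have hmem : ∀ h : T ≃g T, h ∈ GPlus hT hi Y ↔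
      h ∈ autPlus T type ∧ ∀ v, sgnProd hi h (Y 0) v = 1 := by
    intro h
    refine ⟨fun H => ⟨H.1, fun v => ?_⟩, fun H => ⟨H.1, fun t v _ => by rw [hYt]; exact H.2 v⟩⟩
    obtain ⟨t, -, ht⟩ := hrel v
    rw [← hYt t]
    exact H.2 t v ht
  obtain ⟨x, hx⟩ := exists_type hd hT 0
  obtain ⟨y, hy⟩ := exists_type hd hT 1
  have hconst : ∀ g ∈ Subgroup.normalizer (GPlus hT hi Y : Set (T ≃g T)),
      ∀ v v', type v' = type v → sgnProd hi g (Y 0) v' = sgnProd hi g (Y 0) v := by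
    intro g hg v v' hv
    obtain ⟨h, hh, rfl⟩ := exists_mem_GPlus_apply_eq hd hT hi Y hv
    have h1 := (hmem _).1 ((Subgroup.mem_normalizer_iff.1 hg h).1 hh)
    have h2 := sgnProd_conj hT hi g h (Y 0) v
    rw [h1.2, ((hmem _).1 hh).2, one_mul, mul_one] at h2
    exact h2.symm
  have hnorm : ∀ (g : T ≃g T) (e : Fin 2 → ℤˣ), (∀ v, sgnProd hi g (Y 0) v = e (type v)) →
      g ∈ Subgroup.normalizer (GPlus hT hi Y : Set (T ≃g T)) := by
    intro g e he
    rw [Subgroup.mem_normalizer_iff]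
    intro h
    rw [hmem, hmem, conj_mem_autPlus_iff hT]
    refine and_congr_right fun hh => ?_
    have key : ∀ v, sgnProd hi (g * h * g⁻¹) (Y 0) (g v) = sgnProd hi h (Y 0) v := by
      intro v
      have h2 := sgnProd_conj hT hi g h (Y 0) v
      rw [he, he, hh v, mul_comm] at h2
      exact mul_left_cancel h2
    exact ⟨fun H v => by rw [← g.apply_symm_apply v]; exact (key _).trans (H _),
      fun H v => by rw [← key]; exact H _⟩
  have hswap : ∀ (b : Bool) (e : Fin 2 → ℤˣ), ∃ g : T ≃g T,
      (type (g x) ≠ 0 ↔ b = true) ∧ ∀ v, sgnProd hi g (Y 0) v = e (type v) := by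
    have hplus : ∀ e : Fin 2 → ℤˣ, ∃ g ∈ autPlus T type, ∀ v,
        sgnProd hi g (Y 0) v = e (type v) := by
      intro e
      obtain ⟨g, hg, hgs⟩ := exists_aut_sgnProd hd hT hi Y
        fun t => e ⟨((t : ℕ) + maxRadius (Y t)) % 2, by omega⟩
      refine ⟨g, hg, fun v => ?_⟩
      obtain ⟨t, ht, hv⟩ := hrel v
      have := hgs t v (by rwa [hYt]) hv
      simp only [hYt] at this
      rw [this]
      congr 1
      exact Fin.ext ht
    intro b e
    cases b with
    | false =>
      obtain ⟨g, hg, hgs⟩ := hplus e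
      exact ⟨g, by simp [hg x, hx], hgs⟩
    | true =>
      obtain ⟨s, hs1, hs2⟩ := exists_swap hd hT hi hdd
      -- In `g * s` the products of `g` are taken at `s v`, which has the other type; hence the
      -- exchanged signs.
      obtain ⟨g, hg, hgs⟩ := hplus fun t => e (1 - t)
      refine ⟨g * s, ?_, fun v => ?_⟩
      · have := hs1 x
        rw [hx] at this
        simpa [hg (s x)] using this
      · have h1 : sgnProd hi s (Y 0) v = 1 := by simp [sgnProd, hs2]
        rw [sgnProd_mul hT, h1, mul_one, hgs]
        congr 1
        have := hs1 v
        omega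
  refine nonempty_normalizerQuotient_mulEquiv _ (fun g => dihedralOf (decide (type (g x) ≠ 0))
    (sgnProd hi g (Y 0) x) (sgnProd hi g (Y 0) y)) ?_ ?_ ?_
  · intro g hg h hh
    rw [← dihedralOf_mul, sgnProd_mul hT, sgnProd_mul hT]
    have hxy : type (h x) ≠ type (h y) := by
      rw [Ne, type_apply_eq_iff hT, hx, hy]
      decide
    have hgxy : type (g x) ≠ type (g y) := by
      rw [Ne, type_apply_eq_iff hT, hx, hy]
      decide
    by_cases h0 : type (h x) = 0
    · rw [hconst g hg x (h x) (by rw [h0, hx]), hconst g hg y (h y) (by rw [hy]; omega)]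
      have : type (g (h x)) = type (g x) := by rw [type_apply_eq_iff hT, h0, hx]
      simp [h0, this]
    · rw [hconst g hg y (h x) (by rw [hy]; omega), hconst g hg x (h y) (by rw [hx]; omega)]
      have h1 : type (g (h x)) = type (g y) := by
        rw [type_apply_eq_iff hT, hy]; omega
      have h2 : type (g y) ≠ 0 ↔ ¬ type (g x) ≠ 0 := by omega
      simp only [RelIso.mul_apply, h1, h2]
      simp [h0]
  · intro g hg
    rw [dihedralOf_eq_one, hmem]
    refine ⟨fun ⟨h1, h2, h3⟩ => ⟨fun v => ?_, fun v => ?_⟩, fun ⟨h1, h2⟩ => ⟨?_, h2 x, h2 y⟩⟩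
    · have h1 : type (g x) = 0 := by simpa using h1
      have := type_apply_eq_iff hT g v x
      rw [h1, hx] at this
      omega
    · by_cases hv : type v = 0
      · rw [hconst g hg x v (by rw [hv, hx]), h2]
      · rw [hconst g hg y v (by rw [hy]; omega), h3]
    · simp [h1 x, hx]
  · intro z
    obtain ⟨b, a, c, rfl⟩ := dihedralOf_surjective z
    obtain ⟨g, h1, h2⟩ := hswap b ![a, c]
    refine ⟨g, hnorm g _ h2, ?_⟩
    rw [h2, h2, hx, hy]
    congr 1
    rw [Bool.eq_iff_iff, decide_eq_true_iff]
    exact h1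

end Dihedral

end SemiTree

theorem theoremA {V : Type*} (T : SimpleGraph V) (d : Fin 2 → ℕ) (type : V → Fin 2) (i : V → ℕ)
    (hd : ∀ t, 4 ≤ d t) (hT : SemiTree.IsSemiregularTree T d type)
    (hi : SemiTree.IsLegalColoring T d type i) (Y : Fin 2 → Finset ℕ) :
    (SemiTree.GPlus hT hi Y ≤ SemiTree.autPlus T type ∧
      IsClosed (SemiTree.GPlus hT hi Y : Set (T ≃g T)) ∧
      MulAction.IsMultiplyPretransitive (SemiTree.GPlus hT hi Y) (SemiTree.Ends T) 2) ∧
    IsSimpleGroup (SemiTree.GPlus hT hi Y) ∧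
    Nonempty
      (SemiTree.NormalizerQuotient ((SemiTree.GPlus hT hi Y).subgroupOf (SemiTree.autPlus T type))
        ≃* (Fin (Finset.univ.filter fun t : Fin 2 => (Y t).Nonempty).card →
              Multiplicative (ZMod 2))) ∧
    (d 0 = d 1 → Y 0 = Y 1 → (Y 0).Nonempty →
      Nonempty (SemiTree.NormalizerQuotient (SemiTree.GPlus hT hi Y) ≃* DihedralGroup 4)) := by
  exact ⟨⟨fun _ hg => hg.1, SemiTree.isClosed_GPlus hT hi Y,
    SemiTree.isMultiplyPretransitive_GPlus hd hT hi Y⟩, SemiTree.isSimpleGroup_GPlus hd hT hi Y,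
    SemiTree.nonempty_normalizerQuotient_autPlus hd hT hi Y,
    SemiTree.nonempty_normalizerQuotient_aut hd hT hi Y⟩
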